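/- Let $k$ be an algebraically closed field of characteristic zero. Let $K_0(\mathrm{Var}_k)$ be the Grothendieck ring of varieties: the quotient of the free abelian group on isomorphism classes of $k$-schemes of finite type by the relations $[X]=[F]+[X\setminus F]$ for $F$ a closed subscheme of $X$, with product $[X]\cdot[X']=[X\times_k X']$; write $\mathbb{L}=[\mathbb{A}^1_k]$, and $\mathbb{P}^{-1}_k=\emptyset$. Let $X,Y$ be smooth irreducible proper $k$-varieties that are piecewise isomorphic, i.e. there are finite partitions of $X$ and of $Y$ into locally closed subsets which, with their reduced structures, are pairwise isomorphic over $k$. Let $f\colon X\dashrightarrow Y$ be a birational map over $k$, inducing an isomorphism $U\cong V$ of dense open subschemes. Let $$X=X_1\xleftarrow{\,b_1\,}Z_1\xrightarrow{\,c_1\,}X_2\xleftarrow{\,b_2\,}\cdots\xleftarrow{\,b_n\,}Z_n\xrightarrow{\,c_n\,}X_{n+1}=Y$$ be a weak factorization of $f$: all $X_i,Z_i$ are smooth irreducible proper $k$-varieties, the diagram induces $f$, and each $b_i$ and each $c_i$ is a composite of finitely many (possibly zero) blow-ups of smooth irreducible proper $k$-varieties along non-empty smooth irreducible centers disjoint from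 $U$. For $1\le i\le n$, let $C_{ij}$ ($1\le j\le s_i$), of codimension $\alpha_{ij}$ in the variety that is blown up, be the centers of the blow-ups defining $b_i$, and let $D_{ij}$ ($1\le j\le t_i$), of codimension $\beta_{ij}$, be the centers of the blow-ups defining $c_i$. Then, in $K_0(\mathrm{Var}_k)$, $$\mathbb{L}\cdot\sum_{i=1}^n\sum_{j=1}^{s_i}[C_{ij}]\,[\mathbb{P}^{\alpha_{ij}-2}_k]=\mathbb{L}\cdot\sum_{i=1}^n\sum_{j=1}^{t_i}[D_{ij}]\,[\mathbb{P}^{\beta_{ij}-2}_k].$$ -/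

import Mathlib

open CategoryTheory CategoryTheory.Limits AlgebraicGeometry MonoidalCategory

universe u

/-! ### Schemes over a field and their Grothendieck ring -/

/-- The category of schemes over the field `k`. -/
abbrev SchemeOver (k : Type u) [Field k] : Type (u + 1) :=
  Over (Spec (CommRingCat.of k))

/-- A `k`-scheme is of finite type if its structure morphism is locally of finite type and
quasi-compact. -/
def isFiniteType (k : Type u) [Field k] : ObjectProperty (SchemeOver k) :=
  fun X => LocallyOfFiniteType X.hom ∧ QuasiCompact X.hom

/-- Finite type `k`-schemes contain the point `Spec k` and are stable under fibre products
over `k`. -/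
instance isFiniteType_isMonoidal (k : Type u) [Field k] : (isFiniteType k).IsMonoidal where
  prop_unit := by
    change LocallyOfFiniteType (𝟙 _) ∧ QuasiCompact (𝟙 _)
    exact ⟨inferInstance, inferInstance⟩
  prop_tensor X Y hX hY := by
    have := hX.1
    have := hX.2
    have := hY.1
    have := hY.2
    change LocallyOfFiniteType (pullback.fst X.hom Y.hom ≫ X.hom) ∧
      QuasiCompact (pullback.fst X.hom Y.hom ≫ X.hom)
    exact ⟨inferInstance, inferInstance⟩

/-- The category of `k`-schemes of finite type. -/
abbrev FiniteTypeScheme (k : Type u) [Field k] : Type (u + 1) :=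
  (isFiniteType k).FullSubcategory

/-- The commutative ring `ℤ[Var_k]`: the free abelian group on the isomorphism classes of
`k`-schemes of finite type, with multiplication given on generators by the fibre product
over `k`. -/
abbrev FreeVar (k : Type u) [Field k] : Type (u + 1) :=
  FreeAbelianGroup (Skeleton (FiniteTypeScheme k))

/-- The generator of `ℤ[Var_k]` given by a `k`-scheme of finite type. -/
noncomputable def FreeVar.gen {k : Type u} [Field k] (X : FiniteTypeScheme k) : FreeVar k :=
  FreeAbelianGroup.of (toSkeleton X)

/-- The scissor elements `[X] - ([F] + [X ∖ F])`, where `F` is a closed subscheme of the finite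
type `k`-scheme `X`, and `X ∖ F` is the complementary open subscheme `U`. -/
def scissorRelations (k : Type u) [Field k] : Set (FreeVar k) :=
  {r | ∃ (X F U : FiniteTypeScheme k) (i : F ⟶ X) (j : U ⟶ X),
    IsClosedImmersion i.hom.left ∧ IsOpenImmersion j.hom.left ∧
    Set.range j.hom.left = (Set.range i.hom.left)ᶜ ∧
    r = FreeVar.gen X - (FreeVar.gen F + FreeVar.gen U)}

/-- The Grothendieck ring of varieties `K₀(Var_k)`. (The subgroup generated by the scissor
elements is an ideal, because the product of a scissor element with a generator is again a scissor
element.) -/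
abbrev K0Var (k : Type u) [Field k] : Type (u + 1) :=
  FreeVar k ⧸ Ideal.span (scissorRelations k)

/-- The class `[X]` in `K₀(Var_k)` of a `k`-scheme `X` of finite type. -/
noncomputable def K0Var.cls {k : Type u} [Field k] (X : SchemeOver k)
    (h₁ : LocallyOfFiniteType X.hom) (h₂ : QuasiCompact X.hom) : K0Var k :=
  Ideal.Quotient.mk _ (FreeVar.gen ⟨X, h₁, h₂⟩)

/-! ### Affine line and projective spaces -/

/-- The class `𝕃` of the affine line. -/
noncomputable def K0Var.lefschetz (k : Type u) [Field k] : K0Var k :=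
  K0Var.cls (Over.mk (𝔸(PUnit.{u + 1}; Spec (CommRingCat.of k)) ↘ Spec (CommRingCat.of k)))
    (by dsimp; infer_instance) (by dsimp; infer_instance)

/-- The structure morphism of `Proj 𝒜` over `Spec R`, for a graded `R`-algebra `𝒜`. -/
noncomputable def projToSpec {R A : Type u} [CommRing R] [CommRing A] [Algebra R A]
    (𝒜 : ℕ → Submodule R A) [GradedAlgebra 𝒜] : Proj 𝒜 ⟶ Spec (CommRingCat.of R) :=
  Proj.toSpecZero 𝒜 ≫ Spec.map (CommRingCat.ofHom (algebraMap R (𝒜 0)))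

attribute [local instance] MvPolynomial.gradedAlgebra

/-- `Proj k[x₁, …, xₙ]` as a `k`-scheme, i.e. the projective space `ℙ^{n-1}` over `k`
(the empty scheme if `n = 0`). -/
noncomputable def projOfVars (k : Type u) [Field k] (n : ℕ) : SchemeOver k :=
  Over.mk (projToSpec (MvPolynomial.homogeneousSubmodule (Fin n) k))

theorem algebraMap_homogeneousZero_surjective (k : Type u) [Field k] (n : ℕ) :
    Function.Surjective (algebraMap k (MvPolynomial.homogeneousSubmodule (Fin n) k 0)) := by
  rintro ⟨p, hp⟩
  rw [MvPolynomial.homogeneousSubmodule_zero] at hp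
  obtain ⟨c, hc⟩ := Submodule.mem_one.mp hp
  exact ⟨c, Subtype.ext hc⟩

theorem projOfVars_finiteType (k : Type u) [Field k] (n : ℕ) :
    LocallyOfFiniteType (projOfVars k n).hom ∧ QuasiCompact (projOfVars k n).hom := by
  have hs := algebraMap_homogeneousZero_surjective k n
  have : IsClosedImmersion (Spec.map (CommRingCat.ofHom
      (algebraMap k (MvPolynomial.homogeneousSubmodule (Fin n) k 0)))) :=
    IsClosedImmersion.spec_of_surjective _ hs
  have : IsScalarTower k (MvPolynomial.homogeneousSubmodule (Fin n) k 0) (MvPolynomial (Fin n) k) :=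
    ⟨fun a b c => smul_mul_assoc a (b : MvPolynomial (Fin n) k) c⟩
  have : Algebra.FiniteType (MvPolynomial.homogeneousSubmodule (Fin n) k 0)
      (MvPolynomial (Fin n) k) :=
    Algebra.FiniteType.of_restrictScalars_finiteType k _ _
  dsimp [projOfVars, projToSpec]
  exact ⟨inferInstance, inferInstance⟩

/-- The class of `ℙ^m` over `k` in `K₀(Var_k)`, for an integer `m ≥ -1`, where `ℙ^{-1}` is the
empty scheme. -/
noncomputable def K0Var.projClass (k : Type u) [Field k] (m : ℤ) : K0Var k :=
  K0Var.cls (projOfVars k (m + 1).toNat) (projOfVars_finiteType k _).1 (projOfVars_finiteType k _).2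

/-! ### Blow-ups -/

/-- The degree `n` part `Iⁿ tⁿ` of the Rees algebra `⨁ Iⁿ tⁿ ⊆ R[t]`. -/
noncomputable def reesGrading {R : Type u} [CommRing R] (I : Ideal R) (n : ℕ) : Submodule R (reesAlgebra I) :=
  (LinearMap.range (Polynomial.monomial (R := R) n)).comap (reesAlgebra I).val.toLinearMap

theorem mem_reesGrading {R : Type u} [CommRing R] {I : Ideal R} {n : ℕ} {x : reesAlgebra I} :
    x ∈ reesGrading I n ↔ ∃ r, Polynomial.monomial n r = (x : Polynomial R) :=
  Iff.rfl

/-- The homogeneous component of degree `n` of an element of the Rees algebra. -/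
noncomputable def reesComponent {R : Type u} [CommRing R] (I : Ideal R) (x : reesAlgebra I) (n : ℕ) :
    reesGrading I n :=
  ⟨⟨Polynomial.monomial n ((x : Polynomial R).coeff n), reesAlgebra.monomial_mem.mpr (x.2 n)⟩,
    (x : Polynomial R).coeff n, rfl⟩

theorem reesComponent_of_mem {R : Type u} [CommRing R] (I : Ideal R) {n : ℕ} (x : reesGrading I n)
    (m : ℕ) : reesComponent I x.1 m = DirectSum.of (fun i => reesGrading I i) n x m := by
  obtain ⟨⟨p, hp⟩, r, hr⟩ := x
  change Polynomial.monomial n r = p at hr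
  subst hr
  by_cases h : n = m
  · subst h
    rw [DirectSum.of_eq_same]
    apply Subtype.ext
    apply Subtype.ext
    change Polynomial.monomial n ((Polynomial.monomial n r).coeff n) = _
    simp
  · rw [DirectSum.of_eq_of_ne _ _ _ (Ne.symm h)]
    apply Subtype.ext
    apply Subtype.ext
    change Polynomial.monomial m ((Polynomial.monomial n r).coeff m) = 0
    simp [Polynomial.coeff_monomial, h]

theorem reesComponent_add {R : Type u} [CommRing R] (I : Ideal R) (y z : reesAlgebra I) (m : ℕ) :
    reesComponent I (y + z) m = reesComponent I y m + reesComponent I z m := by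
  apply Subtype.ext
  apply Subtype.ext
  change Polynomial.monomial m (((y : Polynomial R) + (z : Polynomial R)).coeff m) =
    Polynomial.monomial m ((y : Polynomial R).coeff m) +
      Polynomial.monomial m ((z : Polynomial R).coeff m)
  rw [Polynomial.coeff_add, map_add]

noncomputable instance reesGrading_gradedAlgebra {R : Type u} [CommRing R] (I : Ideal R) :
    GradedAlgebra (reesGrading I) where
  one_mem := ⟨1, rfl⟩
  mul_mem := by
    rintro i j x y ⟨r, hr⟩ ⟨s, hs⟩
    refine ⟨r * s, ?_⟩
    change _ = (x : Polynomial R) * (y : Polynomial R)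
    change _ = (x : Polynomial R) at hr
    change _ = (y : Polynomial R) at hs
    rw [← hr, ← hs, Polynomial.monomial_mul_monomial]
  decompose' x := ∑ i ∈ (x : Polynomial R).support,
    DirectSum.of (fun i => reesGrading I i) i (reesComponent I x i)
  left_inv x := by
    rw [map_sum]
    simp only [DirectSum.coeAddMonoidHom_of]
    apply Subtype.ext
    rw [AddSubmonoidClass.coe_finsetSum]
    exact ((x : Polynomial R).as_sum_support).symm
  right_inv x := by
    classical
    have key : ∀ y : reesAlgebra I, ∀ m, (∑ i ∈ (y : Polynomial R).support,
        DirectSum.of (fun i => reesGrading I i) i (reesComponent I y i)) m =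
          reesComponent I y m := by
      intro y m
      rw [DFinsupp.finsetSum_apply]
      by_cases hm : m ∈ (y : Polynomial R).support
      · rw [Finset.sum_eq_single m]
        · exact DirectSum.of_eq_same _ _
        · intro b _ hb
          exact DirectSum.of_eq_of_ne _ _ _ hb.symm
        · exact fun h => absurd hm h
      · rw [Finset.sum_eq_zero]
        · have h0 : (y : Polynomial R).coeff m = 0 := by simpa using hm
          apply Subtype.ext
          apply Subtype.ext
          change (0 : Polynomial R) = Polynomial.monomial m ((y : Polynomial R).coeff m)
          simp [h0]
        · intro b hb
          refine DirectSum.of_eq_of_ne _ _ _ ?_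
          rintro rfl
          exact hm hb
    refine DFinsupp.ext fun m => ?_
    refine (key _ m).trans ?_
    induction x using DirectSum.induction_on with
    | zero =>
      rw [map_zero]
      apply Subtype.ext
      apply Subtype.ext
      change Polynomial.monomial m ((0 : Polynomial R).coeff m) = 0
      simp
    | of i x =>
      rw [DirectSum.coeAddMonoidHom_of]
      exact reesComponent_of_mem I x m
    | add y z hy hz =>
      rw [map_add, reesComponent_add, hy, hz]
      rfl

/-- `π : W ⟶ V` is the blow-up of `V` along the closed subscheme defined by the ideal sheaf `I`,
i.e. the relative `Proj` of `⨁ Iⁿ`: over each affine open `U` of `V` it is isomorphic, over `U`,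
to `Proj (⨁ I(U)ⁿ)`. (Such isomorphisms over `U` are unique, since the exceptional divisor is
an effective Cartier divisor, so there is no further compatibility to ask for.) -/
def IsBlowUp {W V : Scheme.{u}} (π : W ⟶ V) (I : V.IdealSheafData) : Prop :=
  ∀ U : V.affineOpens,
    ∃ e : (π ⁻¹ᵁ U.1).toScheme ≅ Proj (reesGrading (I.ideal U)),
      e.hom ≫ projToSpec (reesGrading (I.ideal U)) ≫ U.2.fromSpec = (π ⁻¹ᵁ U.1).ι ≫ π

/-- The codimension of the closed subset of `V` defined by the ideal sheaf `I`: the infimum of the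
dimensions of the local rings of `V` at its points (`Order.coheight x` is the dimension of the
local ring at `x`). -/
noncomputable def codimension {V : Scheme.{u}} (I : V.IdealSheafData) : ℕ∞ :=
  ⨅ x : (I.support : Set V), Order.coheight (x : V)

/-! ### Smooth proper varieties, piecewise isomorphisms, weak factorizations -/

/-- Smooth irreducible proper `k`-varieties. -/
structure IsSmoothProperVariety {k : Type u} [Field k] (X : SchemeOver k) : Prop where
  smooth : Smooth X.hom
  proper : IsProper X.hom
  irreducible : IrreducibleSpace X.left

/-- `X` and `Y` are piecewise isomorphic: there are finite partitions of `X` and of `Y` into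
locally closed subsets which, with their reduced scheme structures, are pairwise isomorphic
over `k`. -/
def PiecewiseIsomorphic {k : Type u} [Field k] (X Y : SchemeOver k) : Prop :=
  ∃ (m : ℕ) (V W : Fin m → SchemeOver k) (i : ∀ a, V a ⟶ X) (j : ∀ a, W a ⟶ Y),
    (∀ a, IsReduced (V a).left ∧ IsImmersion (i a).left) ∧
    (∀ a, IsReduced (W a).left ∧ IsImmersion (j a).left) ∧
    (∀ x : X.left, ∃! a, x ∈ Set.range (i a).left) ∧
    (∀ y : Y.left, ∃! a, y ∈ Set.range (j a).left) ∧
    ∀ a, Nonempty (V a ≅ W a)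

/-- The data exhibiting `π : W ⟶ V` as the blow-up of `V` along a (non-empty) smooth irreducible
center. -/
structure SmoothBlowUp {k : Type u} [Field k] {W V : SchemeOver k} (π : W ⟶ V) where
  /-- the ideal sheaf of the center -/
  ideal : V.left.IdealSheafData
  smooth_center : Smooth (ideal.subschemeι ≫ V.hom)
  irreducible_center : IrreducibleSpace ideal.subscheme
  isBlowUp : IsBlowUp π.left ideal
  /-- the codimension of the center -/
  codim : ℕ
  codim_eq : (codim : ℕ∞) = codimension ideal

/-- A presentation of `b : Z ⟶ X` as a composite of blow-ups
`Z ≅ stage s ⟶ ⋯ ⟶ stage 1 ⟶ stage 0 ≅ X` of smooth irreducible proper varieties, with smooth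
irreducible centers disjoint from `U`. Here `U` is mapped to `Z` by `u`, and so to each stage.
If `s = 0`, then `b` is an isomorphism. -/
structure BlowUpSequence {k : Type u} [Field k] {U : Scheme.{u}} {Z X : SchemeOver k}
    (u : U ⟶ Z.left) (b : Z ⟶ X) where
  /-- the number `s` of blow-ups -/
  length : ℕ
  stage : Fin (length + 1) → SchemeOver k
  stage_variety : ∀ j, IsSmoothProperVariety (stage j)
  map : ∀ j : Fin length, stage j.succ ⟶ stage j.castSucc
  blowUp : ∀ j, SmoothBlowUp (map j)
  bottom : stage 0 ≅ X
  /-- the composite `Z ⟶ stage j` -/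
  proj : ∀ j, Z ⟶ stage j
  isIso_proj_last : IsIso (proj (Fin.last length))
  proj_succ : ∀ j : Fin length, proj j.succ ≫ map j = proj j.castSucc
  proj_zero : proj 0 ≫ bottom.hom = b
  disjoint : ∀ j : Fin length,
    Disjoint (Set.range (u ≫ (proj j.castSucc).left))
      ((blowUp j).ideal.support : Set (stage j.castSucc).left)

namespace BlowUpSequence

variable {k : Type u} [Field k] {U : Scheme.{u}} {Z X : SchemeOver k} {u : U ⟶ Z.left} {b : Z ⟶ X}

/-- The center of the `j`-th blow-up, as a `k`-scheme. -/
noncomputable def center (S : BlowUpSequence u b) (j : Fin S.length) : SchemeOver k :=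
  Over.mk ((S.blowUp j).ideal.subschemeι ≫ (S.stage j.castSucc).hom)

theorem center_finiteType (S : BlowUpSequence u b) (j : Fin S.length) :
    LocallyOfFiniteType (S.center j).hom ∧ QuasiCompact (S.center j).hom := by
  have := (S.stage_variety j.castSucc).proper
  dsimp [center]
  exact ⟨inferInstance, inferInstance⟩

/-- The class in `K₀(Var_k)` of the center of the `j`-th blow-up. -/
noncomputable def centerClass (S : BlowUpSequence u b) (j : Fin S.length) : K0Var k :=
  K0Var.cls (S.center j) (S.center_finiteType j).1 (S.center_finiteType j).2

/-- The codimension of the center of the `j`-th blow-up. -/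
def codim (S : BlowUpSequence u b) (j : Fin S.length) : ℕ :=
  (S.blowUp j).codim

end BlowUpSequence

/-- A weak factorization of a birational map `f : X ⇢ Y`, which induces an isomorphism
from the dense open `U = f.source` of `X` onto the dense open `f.target` of `Y`: a diagram
`X ≅ X₁ ⟵ Z₁ ⟶ X₂ ⟵ ⋯ ⟵ Zₙ ⟶ Xₙ₊₁ ≅ Y` of smooth irreducible proper varieties in which all
arrows are composites of blow-ups with smooth irreducible centers disjoint from `U`. The maps
`inclX`, `inclZ` identify `U` with an open subscheme of all the varieties in the diagram; their
compatibilities say that the diagram induces the birational map `f`. -/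
structure WeakFactorization {k : Type u} [Field k] {X Y : SchemeOver k}
    (f : X.left.PartialIso Y.left) where
  n : ℕ
  X' : Fin (n + 1) → SchemeOver k
  Z : Fin n → SchemeOver k
  X'_variety : ∀ i, IsSmoothProperVariety (X' i)
  Z_variety : ∀ i, IsSmoothProperVariety (Z i)
  b : ∀ i : Fin n, Z i ⟶ X' i.castSucc
  c : ∀ i : Fin n, Z i ⟶ X' i.succ
  first : X' 0 ≅ X
  last : X' (Fin.last n) ≅ Y
  inclX : ∀ i, f.source.toScheme ⟶ (X' i).left
  inclZ : ∀ i, f.source.toScheme ⟶ (Z i).left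
  inclX_open : ∀ i, IsOpenImmersion (inclX i)
  inclZ_open : ∀ i, IsOpenImmersion (inclZ i)
  inclX_first : inclX 0 ≫ first.hom.left = f.source.ι
  inclX_last : inclX (Fin.last n) ≫ last.hom.left = f.iso.hom ≫ f.target.ι
  inclZ_b : ∀ i, inclZ i ≫ (b i).left = inclX i.castSucc
  inclZ_c : ∀ i, inclZ i ≫ (c i).left = inclX i.succ
  bSeq : ∀ i, BlowUpSequence (inclZ i) (b i)
  cSeq : ∀ i, BlowUpSequence (inclZ i) (c i)

/-! The heart of the matter is the blow-up formula: if `W` is the blow-up of a smooth `V` along a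
smooth irreducible center `C` of codimension `α`, then `[W] = [V] + 𝕃 [C] [ℙ^{α-2}]`. Indeed `W` is
unchanged over `V ∖ C` and is a `ℙ^{α-1}`-bundle over `C`, and `[ℙ^{α-1}] = 1 + 𝕃 [ℙ^{α-2}]`
(`SmoothBlowUp.classOf_eq`). Added up along a sequence of blow-ups, it turns the contribution of
`bᵢ` into `[Zᵢ] - [Xᵢ]` and that of `cᵢ` into `[Zᵢ] - [Xᵢ₊₁]`. The difference of the two sides
telescopes to `[Y] - [X]`, which vanishes because the class is additive over finite partitions into
locally closed pieces (`K0Var.classOf_eq_sum`).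

The bundle statement is expressed by `HasFiberClass`: all pullbacks to finite type schemes multiply
classes by a fixed `κ`. This property is local on the target (`HasFiberClass.of_local`), so no
global trivialization is needed. For `Proj` of an algebra generated in degree one it follows from
the Schubert cell decomposition, once there is a map to a polynomial ring sending the generators to
the variables (`HasFiberClass.proj`).

For Rees algebras such a map exists when the ideal is generated by a quasi-regular sequence. A
smooth center is locally of this kind: the conormal sequence splits, which gives derivations dual to
local generators `f`. Formal smoothness integrates them to a Taylor expansion with values in a
truncated polynomial ring, in which `f i` has leading term `X i`; comparing leading forms proves
quasi-regularity (`coeff_mem_ker_of_derivation`). The length of the sequence is the codimension, by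
Krull's height theorem in one direction and by successively dividing out nonzerodivisors in the
other. -/

/-! ### Classes of finite type schemes -/

namespace K0Var

variable {k : Type u} [Field k]

open Classical in
/-- The class in `K₀(Var_k)` of the source of a morphism `t : X ⟶ Spec k`, with the value `0`
if `t` is not of finite type. -/
noncomputable def classOf {X : Scheme.{u}} (t : X ⟶ Spec (CommRingCat.of k)) : K0Var k :=
  if h : LocallyOfFiniteType t ∧ QuasiCompact t then cls (Over.mk t) h.1 h.2 else 0

theorem classOf_eq {X : Scheme.{u}} (t : X ⟶ Spec (CommRingCat.of k))
    [h₁ : LocallyOfFiniteType t] [h₂ : QuasiCompact t] :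
    classOf t = cls (Over.mk t) h₁ h₂ :=
  dif_pos ⟨h₁, h₂⟩

theorem cls_eq_classOf (X : SchemeOver k) (h₁ : LocallyOfFiniteType X.hom)
    (h₂ : QuasiCompact X.hom) : cls X h₁ h₂ = classOf X.hom :=
  (classOf_eq X.hom).symm

theorem classOf_iso {X Y : Scheme.{u}} (e : X ⟶ Y) [IsIso e] (t : Y ⟶ Spec (CommRingCat.of k)) :
    classOf (e ≫ t) = classOf t := by
  have h₁ : LocallyOfFiniteType (e ≫ t) ↔ LocallyOfFiniteType t :=
    ⟨fun _ => by rw [← IsIso.inv_hom_id_assoc e t]; infer_instance, fun _ => inferInstance⟩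
  have h₂ : QuasiCompact (e ≫ t) ↔ QuasiCompact t :=
    ⟨fun _ => by rw [← IsIso.inv_hom_id_assoc e t]; infer_instance, fun _ => inferInstance⟩
  by_cases h : LocallyOfFiniteType t ∧ QuasiCompact t
  · obtain ⟨_, _⟩ := h
    rw [classOf_eq, classOf_eq]
    exact congrArg (fun x => Ideal.Quotient.mk _ (FreeAbelianGroup.of x))
      (toSkeleton_eq_toSkeleton_iff.mpr ⟨(isFiniteType k).isoMk (Over.isoMk (asIso e))⟩)
  · rw [classOf, classOf, dif_neg h, dif_neg (by rwa [h₁, h₂])]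

theorem classOf_eq_of_iso {X Y : Scheme.{u}} (e : X ≅ Y) {s : X ⟶ Spec (CommRingCat.of k)}
    {t : Y ⟶ Spec (CommRingCat.of k)} (h : e.hom ≫ t = s) : classOf s = classOf t := by
  rw [← h, classOf_iso]

theorem classOf_eq_of_overIso {X Y : SchemeOver k} (e : X ≅ Y) : classOf X.hom = classOf Y.hom :=
  classOf_eq_of_iso ((Over.forget _).mapIso e) (Over.w e.hom)

section finiteness

variable {X : Scheme.{u}} (t : X ⟶ Spec (CommRingCat.of k)) [LocallyOfFiniteType t]
  [QuasiCompact t]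

include t in
theorem isNoetherian_of_finiteType : IsNoetherian X := by
  have := LocallyOfFiniteType.isLocallyNoetherian t
  have := (quasiCompact_iff_compactSpace (f := t)).mp inferInstance
  exact {}

/-- A finite type `k`-scheme is a noetherian space, so every subspace is compact. Hence all locally
closed pieces below are again of finite type. -/
theorem quasiCompact_immersion_comp {V : Scheme.{u}} (i : V ⟶ X) [IsImmersion i] :
    QuasiCompact (i ≫ t) := by
  have := isNoetherian_of_finiteType t
  have : TopologicalSpace.NoetherianSpace V :=
    i.isEmbedding.isInducing.noetherianSpace
  infer_instance

theorem classOf_add {F U : Scheme.{u}} (i : F ⟶ X) (j : U ⟶ X) [IsClosedImmersion i]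
    [IsOpenImmersion j] (h : Set.range j = (Set.range i)ᶜ) :
    classOf t = classOf (i ≫ t) + classOf (j ≫ t) := by
  have := quasiCompact_immersion_comp t j
  rw [classOf_eq t, classOf_eq (i ≫ t), classOf_eq (j ≫ t)]
  unfold cls
  rw [← map_add, Ideal.Quotient.mk_eq_mk_iff_sub_mem]
  refine Ideal.subset_span ⟨_, _, _, ObjectProperty.homMk (Over.homMk i), ObjectProperty.homMk
    (Over.homMk j), ?_, ?_, ?_, rfl⟩
  · assumption
  · assumption
  · exact h

end finiteness

theorem classOf_of_isEmpty {X : Scheme.{u}} [IsEmpty X] (t : X ⟶ Spec (CommRingCat.of k)) :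
    classOf t = 0 := by
  have : QuasiCompact t := inferInstance
  have : LocallyOfFiniteType t := inferInstance
  -- The empty scheme is at once the closed piece and its complement: `[∅] = [∅] + [∅]`.
  have h := classOf_add t (𝟙 X) (𝟙 X) (Set.eq_of_subset_of_subset (fun x => isEmptyElim x)
    (fun x => isEmptyElim x))
  simpa using h

/-- A surjective immersion is a closed immersion with empty complement, so the scissor relation
makes the class insensitive to nilpotents. -/
theorem classOf_surjective_immersion {X V : Scheme.{u}} (t : X ⟶ Spec (CommRingCat.of k))
    [LocallyOfFiniteType t] [QuasiCompact t] (i : V ⟶ X) [IsImmersion i]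
    (hi : Function.Surjective i) : classOf (i ≫ t) = classOf t := by
  have : IsClosedImmersion i := .of_isPreimmersion _ (by rw [hi.range_eq]; exact isClosed_univ)
  have h := classOf_add t i (⊥ : X.Opens).ι (by simp [hi.range_eq])
  have : IsEmpty (⊥ : X.Opens).toScheme := ⟨fun x => x.2⟩
  rw [classOf_of_isEmpty ((⊥ : X.Opens).ι ≫ t), add_zero] at h
  exact h.symm

theorem classOf_id : classOf (𝟙 (Spec (CommRingCat.of k))) = 1 := by
  rw [classOf_eq]
  rfl

theorem classOf_pullback {X Y : Scheme.{u}} (s : X ⟶ Spec (CommRingCat.of k))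
    (t : Y ⟶ Spec (CommRingCat.of k)) [LocallyOfFiniteType s] [QuasiCompact s]
    [LocallyOfFiniteType t] [QuasiCompact t] :
    classOf (pullback.fst s t ≫ s) = classOf s * classOf t := by
  rw [classOf_eq, classOf_eq, classOf_eq]
  unfold cls
  rw [← map_mul]
  refine congrArg (Ideal.Quotient.mk _) (Eq.trans ?_ (FreeAbelianGroup.of_mul_of _ _).symm)
  exact congrArg FreeAbelianGroup.of (Skeleton.toSkeleton_tensorObj
    (⟨Over.mk s, ‹_›, ‹_›⟩ : FiniteTypeScheme k) ⟨Over.mk t, ‹_›, ‹_›⟩)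

theorem classOf_of_isPullback {P X Y : Scheme.{u}} {f : P ⟶ X} {g : P ⟶ Y}
    {s : X ⟶ Spec (CommRingCat.of k)} {t : Y ⟶ Spec (CommRingCat.of k)} [LocallyOfFiniteType s]
    [QuasiCompact s] [LocallyOfFiniteType t] [QuasiCompact t] (h : IsPullback f g s t) :
    classOf (f ≫ s) = classOf s * classOf t := by
  rw [← classOf_pullback, ← classOf_iso h.isoPullback.hom, IsPullback.isoPullback_hom_fst_assoc]

/-- The scissor relation, pulled back along a morphism. -/
theorem classOf_add_pullback {X Y F U : Scheme.{u}} (t : Y ⟶ Spec (CommRingCat.of k))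
    [LocallyOfFiniteType t] [QuasiCompact t] (h : Y ⟶ X) (i : F ⟶ X) (j : U ⟶ X)
    [IsClosedImmersion i] [IsOpenImmersion j] (hij : Set.range j = (Set.range i)ᶜ) :
    classOf t = classOf (pullback.fst h i ≫ t) + classOf (pullback.fst h j ≫ t) := by
  refine classOf_add t _ _ ?_
  rw [Scheme.Pullback.range_fst, Scheme.Pullback.range_fst, hij, Set.preimage_compl]

/-- Transitivity of base change: cutting a piece out of `S` and then restricting it to `S'` is the
same as cutting it out of `S'`. -/
theorem classOf_pullback_comp {X Y S S' : Scheme.{u}} (a : Y ⟶ X) (g : S ⟶ X) (p : S' ⟶ S)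
    (t : S ⟶ Spec (CommRingCat.of k)) :
    classOf (pullback.fst (pullback.snd a g) p ≫ pullback.snd a g ≫ t) =
      classOf (pullback.snd a (p ≫ g) ≫ p ≫ t) := by
  have h : IsPullback (pullback.fst (pullback.snd a g) p ≫ pullback.fst a g)
      (pullback.snd (pullback.snd a g) p) a (p ≫ g) :=
    (IsPullback.of_hasPullback (pullback.snd a g) p).paste_horiz (IsPullback.of_hasPullback a g)
  rw [pullback.condition_assoc, ← classOf_iso h.isoPullback.hom,
    IsPullback.isoPullback_hom_snd_assoc]

end K0Var

/-! ### Additivity for finite partitions into locally closed pieces -/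

theorem exists_closedImmersion_range_compl {X : Scheme.{u}} (U : X.Opens) :
    ∃ (F : Scheme.{u}) (i : F ⟶ X), IsClosedImmersion i ∧ Set.range U.ι = (Set.range i)ᶜ := by
  let Z : TopologicalSpace.Closeds X := U.compl
  refine ⟨_, (Scheme.IdealSheafData.vanishingIdeal Z).subschemeι, inferInstance, ?_⟩
  have h := (Scheme.IdealSheafData.vanishingIdeal Z).range_subschemeι
  rw [Scheme.IdealSheafData.coe_support_vanishingIdeal] at h
  rw [h, Scheme.Opens.range_ι]
  simp [Z]

theorem exists_openImmersion_range_compl {F X : Scheme.{u}} (i : F ⟶ X) [IsClosedImmersion i] :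
    ∃ (U : Scheme.{u}) (j : U ⟶ X), IsOpenImmersion j ∧ Set.range j = (Set.range i)ᶜ :=
  let U : X.Opens := ⟨(Set.range i)ᶜ, i.isClosedEmbedding.isClosed_range.isOpen_compl⟩
  ⟨U, U.ι, inferInstance, U.range_ι⟩

namespace K0Var

variable {k : Type u} [Field k]

theorem classOf_eq_sum_pullback_of_closed_open {X : Scheme.{u}} {ι : Type*} [Fintype ι]
    {V : ι → Scheme.{u}} (i : ∀ a, V a ⟶ X) [∀ a, IsImmersion (i a)]
    {S F U : Scheme.{u}} (g : S ⟶ X) (t : S ⟶ Spec (CommRingCat.of k))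
    [LocallyOfFiniteType t] [QuasiCompact t] (p : F ⟶ S) (q : U ⟶ S)
    [IsClosedImmersion p] [IsOpenImmersion q] (h : Set.range q = (Set.range p)ᶜ)
    (hp : classOf (p ≫ t) = ∑ a, classOf (pullback.snd (i a) (p ≫ g) ≫ p ≫ t))
    (hq : classOf (q ≫ t) = ∑ a, classOf (pullback.snd (i a) (q ≫ g) ≫ q ≫ t)) :
    classOf t = ∑ a, classOf (pullback.snd (i a) g ≫ t) := by
  rw [classOf_add t p q h, hp, hq, ← Finset.sum_add_distrib]
  refine Finset.sum_congr rfl fun a _ => ?_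
  have := quasiCompact_immersion_comp t (pullback.snd (i a) g)
  rw [classOf_add_pullback (pullback.snd (i a) g ≫ t) (pullback.snd (i a) g) p q h,
    classOf_pullback_comp, classOf_pullback_comp]

/-- `D` is the set of pieces not yet known to contain or to miss the image of `S`. Each step cuts
`S` into strata for which one more piece is decided, which is why the statement concerns arbitrary
`S ⟶ X`. When nothing is undecided, a nonempty `S` lies in exactly one piece, and its pullback to
that piece is a surjective immersion. -/
theorem classOf_eq_sum_pullback_of_decided {X : Scheme.{u}} {ι : Type*} [Fintype ι]
    [DecidableEq ι] {V : ι → Scheme.{u}} (i : ∀ a, V a ⟶ X) [∀ a, IsImmersion (i a)]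
    (hi : ∀ x, ∃! a, x ∈ Set.range (i a)) (D : Finset ι) :
    ∀ {S : Scheme.{u}} (g : S ⟶ X) (t : S ⟶ Spec (CommRingCat.of k))
      [LocallyOfFiniteType t] [QuasiCompact t],
      (∀ a ∉ D, (∀ s, g s ∈ Set.range (i a)) ∨ (∀ s, g s ∉ Set.range (i a))) →
      classOf t = ∑ a, classOf (pullback.snd (i a) g ≫ t) := by
  induction D using Finset.induction_on with
  | empty =>
    intro S g t _ _ h
    have hempty : ∀ a, (∀ s, g s ∉ Set.range (i a)) →
        classOf (pullback.snd (i a) g ≫ t) = 0 := by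
      intro a ha
      have : IsEmpty (pullback (i a) g : Scheme.{u}) := by
        refine ⟨fun x => ?_⟩
        have hx : pullback.snd (i a) g x ∈ Set.range (pullback.snd (i a) g) := ⟨x, rfl⟩
        rw [Scheme.Pullback.range_snd] at hx
        exact ha _ hx
      exact classOf_of_isEmpty _
    by_cases hS : IsEmpty S
    · rw [classOf_of_isEmpty, Finset.sum_eq_zero fun a _ => hempty a fun s => isEmptyElim s]
    obtain ⟨s⟩ := not_isEmpty_iff.mp hS
    obtain ⟨a, ha, hau⟩ := hi (g s)
    have hall := (h a (by simp)).resolve_right fun h' => h' s ha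
    rw [Finset.sum_eq_single a]
    · refine (classOf_surjective_immersion t _ ?_).symm
      rw [← Set.range_eq_univ, Scheme.Pullback.range_snd]
      exact Set.eq_univ_of_forall hall
    · intro b _ hb
      exact hempty b ((h b (by simp)).resolve_left fun h' => hb (hau b (h' s)))
    · simp
  | insert a D _ ih =>
    intro S g t _ _ h
    have hcomp : ∀ {S' : Scheme.{u}} (p : S' ⟶ S) (g' : S' ⟶ X)
        (t' : S' ⟶ Spec (CommRingCat.of k)) (_ : p ≫ g = g') [LocallyOfFiniteType t']
        [QuasiCompact t'],
        ((∀ s, g (p s) ∈ Set.range (i a)) ∨ (∀ s, g (p s) ∉ Set.range (i a))) →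
        classOf t' = ∑ a, classOf (pullback.snd (i a) g' ≫ t') := by
      rintro S' p _ t' rfl _ _ ha
      refine ih (p ≫ g) t' fun b hb => ?_
      by_cases hba : b = a
      · subst hba
        exact ha
      · rcases h b (by simp [hba, hb]) with h | h
        · exact .inl fun s => h (p s)
        · exact .inr fun s => h (p s)
    -- A locally closed piece is closed in its coborder, which is open. This gives three strata of
    -- `S`: the complement of `O`, the piece `c` closed in `O`, and the rest of `O`.
    let O : S.Opens := g ⁻¹ᵁ (i a).coborderRange
    have hO : ∀ s, g s ∈ Set.range (i a) → s ∈ O := by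
      rintro s ⟨v, hv⟩
      change g s ∈ (i a).coborderRange
      rw [← hv]
      have h : (i a).coborderRange.ι ((i a).liftCoborder v) ∈ (i a).coborderRange :=
        ((i a).liftCoborder v).2
      rwa [← Scheme.Hom.comp_apply, Scheme.Hom.liftCoborder_ι] at h
    obtain ⟨F, p, _, hFp⟩ := exists_closedImmersion_range_compl O
    have hnotin : ∀ x, p x ∉ O := by
      intro x hx
      have : p x ∈ (Set.range p)ᶜ := by
        rw [← hFp, Scheme.Opens.range_ι]
        exact hx
      exact this ⟨x, rfl⟩
    refine classOf_eq_sum_pullback_of_closed_open i g t p O.ι hFp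
      (hcomp p _ _ rfl (.inr fun s hs => hnotin s (hO _ hs))) ?_
    have := quasiCompact_immersion_comp t O.ι
    let c := pullback.snd (i a).liftCoborder (g ∣_ (i a).coborderRange)
    have hc : Set.range c = {s | g (O.ι s) ∈ Set.range (i a)} := by
      rw [Scheme.Pullback.range_snd]
      ext s
      have hs : (i a).coborderRange.ι ((g ∣_ (i a).coborderRange) s) = g (O.ι s) := by
        rw [← Scheme.Hom.comp_apply, morphismRestrict_ι, Scheme.Hom.comp_apply]
      constructor
      · rintro ⟨v, hv⟩
        refine ⟨v, ?_⟩
        rw [← hs, ← hv, ← Scheme.Hom.comp_apply, Scheme.Hom.liftCoborder_ι]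
      · rintro ⟨v, hv⟩
        refine ⟨v, (i a).coborderRange.ι.isOpenEmbedding.injective ?_⟩
        rw [hs, ← hv, ← Scheme.Hom.comp_apply, Scheme.Hom.liftCoborder_ι]
    obtain ⟨U, q, _, hq⟩ := exists_openImmersion_range_compl c
    have := quasiCompact_immersion_comp (O.ι ≫ t) q
    refine classOf_eq_sum_pullback_of_closed_open i (O.ι ≫ g) (O.ι ≫ t) c q hq ?_ ?_
    · exact hcomp (c ≫ O.ι) _ _ (Category.assoc _ _ _) (.inl fun s => by
        have : c s ∈ Set.range c := ⟨s, rfl⟩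
        rwa [hc] at this)
    · exact hcomp (q ≫ O.ι) _ _ (Category.assoc _ _ _) (.inr fun s => by
        have : q s ∈ Set.range q := ⟨s, rfl⟩
        rwa [hq, hc] at this)

theorem classOf_eq_sum {X : Scheme.{u}} {ι : Type*} [Fintype ι]
    {V : ι → Scheme.{u}} (i : ∀ a, V a ⟶ X) [∀ a, IsImmersion (i a)]
    (hi : ∀ x, ∃! a, x ∈ Set.range (i a)) (t : X ⟶ Spec (CommRingCat.of k))
    [LocallyOfFiniteType t] [QuasiCompact t] :
    classOf t = ∑ a, classOf (i a ≫ t) := by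
  classical
  rw [classOf_eq_sum_pullback_of_decided i hi Finset.univ (𝟙 X) t (by simp)]
  refine Finset.sum_congr rfl fun a _ => ?_
  rw [← classOf_iso (pullback.fst (i a) (𝟙 X)), pullback.condition_assoc, Category.id_comp]

theorem classOf_eq_of_piecewiseIsomorphic {X Y : SchemeOver k} (h : PiecewiseIsomorphic X Y)
    [LocallyOfFiniteType X.hom] [QuasiCompact X.hom] [LocallyOfFiniteType Y.hom]
    [QuasiCompact Y.hom] : classOf X.hom = classOf Y.hom := by
  obtain ⟨m, V, W, i, j, hi, hj, hV, hW, e⟩ := h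
  have := fun a => (hi a).2
  have := fun a => (hj a).2
  rw [classOf_eq_sum (fun a => (i a).left) hV, classOf_eq_sum (fun a => (j a).left) hW]
  refine Finset.sum_congr rfl fun a _ => ?_
  rw [Over.w, Over.w]
  exact classOf_eq_of_overIso (e a).some

end K0Var

/-! ### Morphisms whose fibres have a constant class -/

/-- The morphism `π : W ⟶ V` has fibre class `κ` if the class of every pullback `W ×_V S`, for `S`
of finite type over `k`, is `[S] * κ`. -/
def HasFiberClass {k : Type u} [Field k] {W V : Scheme.{u}} (π : W ⟶ V) (κ : K0Var k) : Prop :=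
  ∀ ⦃S W' : Scheme.{u}⦄ (g : S ⟶ V) (t : S ⟶ Spec (CommRingCat.of k)) (fst : W' ⟶ W)
    (snd : W' ⟶ S), LocallyOfFiniteType t → QuasiCompact t → IsPullback fst snd π g →
      K0Var.classOf (snd ≫ t) = K0Var.classOf t * κ

namespace HasFiberClass

open K0Var

variable {k : Type u} [Field k] {W V : Scheme.{u}} {π : W ⟶ V} {κ : K0Var k}

theorem classOf_comp (h : HasFiberClass π κ) (t : V ⟶ Spec (CommRingCat.of k))
    [h₁ : LocallyOfFiniteType t] [h₂ : QuasiCompact t] :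
    classOf (π ≫ t) = classOf t * κ :=
  h (𝟙 V) t (𝟙 W) π h₁ h₂ (.of_horiz_isIso ⟨by simp⟩)

theorem of_isPullback (h : HasFiberClass π κ) {W' V' : Scheme.{u}} {a : W' ⟶ W} {b : V' ⟶ V}
    {π' : W' ⟶ V'} (hp : IsPullback a π' π b) : HasFiberClass π' κ :=
  fun _ _ g t _ _ h₁ h₂ hq => h (g ≫ b) t _ _ h₁ h₂ (hq.paste_horiz hp)

theorem of_isIso [IsIso π] : HasFiberClass π (1 : K0Var k) := by
  intro S W' g t fst snd _ _ h
  have : IsIso snd := h.isIso_snd_of_isIso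
  rw [classOf_iso, mul_one]

theorem iso_comp (h : HasFiberClass π κ) {W' : Scheme.{u}} (e : W' ⟶ W) [IsIso e] :
    HasFiberClass (e ≫ π) κ :=
  h.of_isPullback (.of_horiz_isIso (fst := e) (g := 𝟙 V) ⟨by simp⟩)

theorem comp (h : HasFiberClass π κ) {X : Scheme.{u}} {ρ : V ⟶ X} {κ' : K0Var k}
    (h' : HasFiberClass ρ κ') [LocallyOfFiniteType ρ] [QuasiCompact ρ] :
    HasFiberClass (π ≫ ρ) (κ' * κ) := by
  intro S W' g t fst snd _ _ hp
  let l : W' ⟶ pullback ρ g := pullback.lift (fst ≫ π) snd (by simpa using hp.w)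
  have hl : l ≫ pullback.snd ρ g = snd := pullback.lift_snd _ _ _
  have hl' : l ≫ pullback.fst ρ g = fst ≫ π := pullback.lift_fst _ _ _
  have hq : IsPullback fst l π (pullback.fst ρ g) := by
    refine IsPullback.of_bot (v₂₁ := pullback.snd ρ g) (v₂₂ := ρ) (h₃₁ := g) ?_ hl'.symm
      (IsPullback.of_hasPullback ρ g)
    rwa [hl]
  rw [← hl, Category.assoc, h _ (pullback.snd ρ g ≫ t) _ _ inferInstance inferInstance hq,
    h' g t _ _ inferInstance inferInstance (IsPullback.of_hasPullback ρ g), mul_assoc]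

theorem of_pieces {ι : Type*} [Fintype ι] {V' : ι → Scheme.{u}} (i : ∀ a, V' a ⟶ W)
    [∀ a, IsImmersion (i a)] (hi : ∀ x, ∃! a, x ∈ Set.range (i a)) {κ : ι → K0Var k}
    (h : ∀ a, HasFiberClass (i a ≫ π) (κ a)) [LocallyOfFiniteType π] [QuasiCompact π] :
    HasFiberClass π (∑ a, κ a) := by
  intro S W' g t fst snd _ _ hp
  have : LocallyOfFiniteType snd := MorphismProperty.of_isPullback hp inferInstance
  have : QuasiCompact snd := MorphismProperty.of_isPullback hp inferInstance
  rw [classOf_eq_sum (fun a => pullback.snd (i a) fst) _ (snd ≫ t), Finset.mul_sum]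
  · refine Finset.sum_congr rfl fun a _ => ?_
    rw [← Category.assoc]
    exact h a g t (pullback.fst (i a) fst) _ inferInstance inferInstance
      ((IsPullback.of_hasPullback (i a) fst).flip.paste_horiz hp.flip).flip
  · intro x
    simp only [Scheme.Pullback.range_snd]
    exact hi (fst x)

/-- By quasi-compactness finitely many of the given opens cover the image of `S`. The scissor
relation splits off the preimage of one of them, and the closed complement is covered by the others;
isomorphisms over the opens never have to be compared on overlaps. -/
theorem of_local [LocallyOfFiniteType π] [QuasiCompact π]
    (h : ∀ x : V, ∃ (U : Scheme.{u}) (j : U ⟶ V), IsOpenImmersion j ∧ x ∈ Set.range j ∧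
      HasFiberClass (pullback.snd π j) κ) : HasFiberClass π κ := by
  classical
  choose U j hj hx hU using h
  have key : ∀ (D : Finset V) ⦃S W' : Scheme.{u}⦄ (g : S ⟶ V) (t : S ⟶ Spec (CommRingCat.of k))
      (fst : W' ⟶ W) (snd : W' ⟶ S), LocallyOfFiniteType t → QuasiCompact t →
      IsPullback fst snd π g → (∀ s, ∃ x ∈ D, g s ∈ Set.range (j x)) →
      classOf (snd ≫ t) = classOf t * κ := by
    intro D
    induction D using Finset.induction_on with
    | empty =>
      intro S W' g t fst snd _ _ _ hs
      have : IsEmpty S := ⟨fun s => by simpa using hs s⟩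
      have : IsEmpty W' := ⟨fun w => isEmptyElim (snd w)⟩
      rw [classOf_of_isEmpty, classOf_of_isEmpty, zero_mul]
    | insert x D _ ih =>
      intro S W' g t fst snd _ _ hp hs
      have : LocallyOfFiniteType snd := MorphismProperty.of_isPullback hp inferInstance
      have : QuasiCompact snd := MorphismProperty.of_isPullback hp inferInstance
      let O : S.Opens := g ⁻¹ᵁ (j x).opensRange
      obtain ⟨F, p, _, hFp⟩ := exists_closedImmersion_range_compl O
      have := quasiCompact_immersion_comp t O.ι
      rw [classOf_add_pullback (snd ≫ t) snd p O.ι hFp, classOf_add t p O.ι hFp, add_mul]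
      congr 1
      · rw [pullback.condition_assoc]
        refine ih (p ≫ g) (p ≫ t) (pullback.fst snd p ≫ fst) _ inferInstance inferInstance
          ((IsPullback.of_hasPullback snd p).flip.paste_vert hp.flip).flip fun s => ?_
        obtain ⟨y, hy, hys⟩ := hs (p s)
        rcases Finset.mem_insert.mp hy with rfl | hy
        · have : p s ∈ (Set.range p)ᶜ := by
            rw [← hFp, Scheme.Opens.range_ι]
            exact hys
          exact absurd ⟨s, rfl⟩ this
        · exact ⟨y, hy, hys⟩
      · rw [pullback.condition_assoc]
        let l : O.toScheme ⟶ U x := IsOpenImmersion.lift (j x) (O.ι ≫ g) (by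
          rintro _ ⟨s, rfl⟩
          exact s.2)
        have hl : l ≫ j x = O.ι ≫ g := IsOpenImmersion.lift_fac _ _ _
        have hq : IsPullback (pullback.fst snd O.ι ≫ fst) (pullback.snd snd O.ι) π (l ≫ j x) := by
          rw [hl]
          exact (IsPullback.of_hasPullback snd O.ι).paste_horiz hp
        exact hU x l (O.ι ≫ t) _ _ inferInstance inferInstance
          (hq.of_right' (IsPullback.of_hasPullback π (j x)))
  intro S W' g t fst snd h₁ h₂ hp
  have : CompactSpace S := (quasiCompact_iff_compactSpace (f := t)).mp inferInstance
  obtain ⟨D, hD⟩ := isCompact_univ.elim_finite_subcover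
    (fun x : V => g ⁻¹' Set.range (j x))
    (fun x => (j x).isOpenEmbedding.isOpen_range.preimage g.continuous)
    (fun s _ => Set.mem_iUnion.mpr ⟨g s, hx (g s)⟩)
  refine key D g t fst snd h₁ h₂ hp fun s => ?_
  simpa using hD (Set.mem_univ s)

theorem affineLine (V : Scheme.{u}) :
    HasFiberClass (𝔸(PUnit.{u + 1}; V) ↘ V) (lefschetz k) := by
  intro S W' g t fst snd _ _ hp
  have h₀ : lefschetz k =
      classOf (𝔸(PUnit.{u + 1}; Spec (CommRingCat.of k)) ↘ Spec (CommRingCat.of k)) :=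
    cls_eq_classOf _ _ _
  have h₁ := AffineSpace.isPullback_map (n := PUnit.{u + 1}) g
  have h₂ := AffineSpace.isPullback_map (n := PUnit.{u + 1}) t
  have e := hp.isoIsPullback _ _ h₁
  have he : (hp.isoIsPullback _ _ h₁).hom ≫ (𝔸(PUnit.{u + 1}; S) ↘ S) = snd := by simp
  rw [h₀, ← he, Category.assoc, classOf_iso, mul_comm, ← classOf_of_isPullback h₂,
    h₂.w]

theorem of_algEquiv {B A A' : Type u} [CommRing B] [CommRing A] [CommRing A'] [Algebra B A]
    [Algebra B A'] (e : A ≃ₐ[B] A')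
    (h : HasFiberClass (Spec.map (CommRingCat.ofHom (algebraMap B A))) κ) :
    HasFiberClass (Spec.map (CommRingCat.ofHom (algebraMap B A'))) κ := by
  have he : Spec.map (CommRingCat.ofHom (algebraMap B A')) =
      Spec.map e.toRingEquiv.toCommRingCatIso.hom ≫
        Spec.map (CommRingCat.ofHom (algebraMap B A)) := by
    rw [← Spec.map_comp]
    congr 1
    ext x
    exact (e.commutes x).symm
  rw [he]
  exact h.iso_comp _

theorem mvPolynomial_punit (B : Type u) [CommRing B] :
    HasFiberClass (Spec.map (CommRingCat.ofHom (algebraMap B (MvPolynomial PUnit.{u + 1} B))))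
      (lefschetz k) := by
  have h := (affineLine (k := k) (Spec (.of B))).iso_comp
    (AffineSpace.SpecIso PUnit.{u + 1} (.of B)).inv
  rwa [AffineSpace.SpecIso_inv_over] at h

/-- Variables are adjoined one at a time. The base ring is quantified inside the induction because
the hypothesis is applied over `B[T]`. -/
theorem mvPolynomial (σ : Type u) [Finite σ] : ∀ (B : Type u) [CommRing B],
    HasFiberClass (Spec.map (CommRingCat.ofHom (algebraMap B (MvPolynomial σ B))))
      (lefschetz k ^ Nat.card σ) := by
  induction σ using Finite.induction_empty_option with
  | of_equiv e ih =>
    intro B _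
    rw [← Nat.card_congr e]
    exact (ih B).of_algEquiv (MvPolynomial.renameEquiv B e)
  | h_empty =>
    intro B _
    simp only [Nat.card_eq_fintype_card, Fintype.card_pempty, pow_zero]
    have h : HasFiberClass (Spec.map (CommRingCat.ofHom (algebraMap B B))) (1 : K0Var k) := by
      have : CommRingCat.ofHom (algebraMap B B) = 𝟙 (CommRingCat.of B) := rfl
      rw [this]
      exact of_isIso
    exact h.of_algEquiv (MvPolynomial.isEmptyAlgEquiv B PEmpty).symm
  | @h_option σ _ ih =>
    intro B _
    rw [Nat.card_eq_fintype_card, Fintype.card_option, ← Nat.card_eq_fintype_card, pow_succ']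
    have : LocallyOfFiniteType (Spec.map (CommRingCat.ofHom (algebraMap B
        (MvPolynomial PUnit.{u + 1} B)))) :=
      HasRingHomProperty.Spec_iff.mpr (RingHom.finiteType_algebraMap.mpr inferInstance)
    have h := (ih (MvPolynomial PUnit.{u + 1} B)).comp (mvPolynomial_punit (k := k) B)
    rw [← Spec.map_comp] at h
    exact HasFiberClass.of_algEquiv (A := MvPolynomial σ (MvPolynomial PUnit.{u + 1} B))
      ((MvPolynomial.renameEquiv B (Equiv.optionEquivSumPUnit.{u} σ)).trans
        (MvPolynomial.sumAlgEquiv B σ PUnit.{u + 1})).symm h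

end HasFiberClass

/-! ### Dehomogenization -/

section dehomogenization

open MvPolynomial

/-- The values of the variables on the `i`-th Schubert cell: `X j` for `i < j`, `1` for `j = i` and
`0` for `j < i`. -/
noncomputable def cellCoord (B : Type*) [CommRing B] {n : ℕ} (i j : Fin n) :
    MvPolynomial {j // i < j} B :=
  if h : i < j then X ⟨j, h⟩ else if j = i then 1 else 0

theorem cellCoord_self (B : Type*) [CommRing B] {n : ℕ} (i : Fin n) : cellCoord B i i = 1 := by
  simp [cellCoord]

theorem cellCoord_of_lt (B : Type*) [CommRing B] {n : ℕ} {i j : Fin n} (h : j < i) :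
    cellCoord B i j = 0 := by
  simp [cellCoord, h.not_gt, h.ne]

theorem map_cellCoord {R B : Type*} [CommRing R] [CommRing B] (f : R →+* B) {n : ℕ} (i j : Fin n) :
    map f (cellCoord R i j) = cellCoord B i j := by
  unfold cellCoord
  split_ifs <;> simp

/-- A ring generated over `R` by elements `y j` with `y i = 1` that maps to the coordinate ring of
the `i`-th cell: the kernel is generated by the `y j` with `j < i` and by the kernel of `R → B`. -/
theorem ker_le_of_cell {R B Z : Type*} [CommRing R] [CommRing B] [CommRing Z] (f : R →+* B)
    (ρ : R →+* Z) {n : ℕ} (i : Fin n) (y : Fin n → Z) (hyi : y i = 1)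
    (hsurj : Function.Surjective (eval₂Hom ρ y)) (φ : Z →+* MvPolynomial {j // i < j} B)
    (hφρ : ∀ r, φ (ρ r) = C (f r)) (hφy : ∀ j, φ (y j) = cellCoord B i j) (q : Ideal Z)
    (hq : ∀ r, f r = 0 → ρ r ∈ q) (hqy : ∀ j < i, y j ∈ q) : RingHom.ker φ ≤ q := by
  intro z hz
  obtain ⟨F, rfl⟩ := hsurj z
  let π := Ideal.Quotient.mk q
  rw [← Ideal.Quotient.eq_zero_iff_mem]
  let ev : MvPolynomial {j // i < j} R →+* Z ⧸ q := eval₂Hom (π.comp ρ) fun j => π (y j)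
  let θ : MvPolynomial (Fin n) R →+* MvPolynomial {j // i < j} R := eval₂Hom C (cellCoord R i)
  -- Modulo `q` the relations `y j = 0` for `j < i` and `y i = 1` hold, so evaluation at `y` factors
  -- through the substitution `θ`. Since `φ` is `θ` followed by reduction of coefficients, an
  -- element of its kernel comes from some `F` for which `θ F` has all coefficients in `ker f`.
  have h₁ : π.comp (eval₂Hom ρ y) = ev.comp θ := by
    refine MvPolynomial.ringHom_ext (fun r => by simp [ev, θ]) fun j => ?_
    simp only [RingHom.comp_apply, eval₂Hom_X', θ, ev]
    rcases lt_trichotomy i j with h | h | h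
    · simp [cellCoord, h]
    · subst h
      simp [cellCoord_self, hyi]
    · rw [cellCoord_of_lt R h, map_zero]
      exact Ideal.Quotient.eq_zero_iff_mem.mpr (hqy j h)
  have h₂ : φ.comp (eval₂Hom ρ y) = (map f).comp θ := by
    refine MvPolynomial.ringHom_ext (fun r => by simp [θ, hφρ]) fun j => ?_
    simp [θ, hφy, map_cellCoord]
  have h₃ : map f (θ F) = 0 := by
    rw [← RingHom.comp_apply, ← h₂]
    exact hz
  change (π.comp (eval₂Hom ρ y)) F = 0
  rw [h₁, RingHom.comp_apply, coe_eval₂Hom, eval₂_eq]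
  refine Finset.sum_eq_zero fun d _ => ?_
  have : f (coeff d (θ F)) = 0 := by rw [← coeff_map, h₃, coeff_zero]
  rw [RingHom.comp_apply, Ideal.Quotient.eq_zero_iff_mem.mpr (hq _ this), zero_mul]

end dehomogenization

/-! ### Standard charts of `Proj` and their Schubert cells -/

section graded

open MvPolynomial HomogeneousLocalization

variable {R A : Type*} [CommRing R] [CommRing A] [Algebra R A] (𝒜 : ℕ → Submodule R A)
  [GradedAlgebra 𝒜] {n : ℕ} {x : Fin n → A}

theorem aeval_mem_of_isHomogeneous (hx : ∀ i, x i ∈ 𝒜 1) {F : MvPolynomial (Fin n) R} {d : ℕ}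
    (hF : F.IsHomogeneous d) : aeval x F ∈ 𝒜 d := by
  rw [aeval_eq_eval₂Hom, coe_eval₂Hom, eval₂_eq']
  refine Submodule.sum_mem _ fun m hm => ?_
  rw [← Algebra.smul_def]
  refine Submodule.smul_mem _ _ ?_
  have hdeg : ∑ j, m j * 1 = d := by
    rw [← hF (mem_support_iff.mp hm), Finsupp.weight_apply, Finsupp.sum_fintype] <;> simp
  rw [← hdeg]
  exact SetLike.prod_pow_mem_graded 𝒜 _ _ _ fun j _ => hx j

theorem exists_isHomogeneous_aeval_eq (hx : ∀ i, x i ∈ 𝒜 1)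
    (hgen : Function.Surjective (aeval x : MvPolynomial (Fin n) R →ₐ[R] A)) {d : ℕ} {a : A}
    (ha : a ∈ 𝒜 d) : ∃ F : MvPolynomial (Fin n) R, F.IsHomogeneous d ∧ aeval x F = a := by
  obtain ⟨F, rfl⟩ := hgen a
  refine ⟨homogeneousComponent d F, homogeneousComponent_isHomogeneous _ _, ?_⟩
  -- The degree `d` projection of `aeval x F` only sees the degree `d` component of `F`, as the
  -- generators have degree one.
  have hsum := congrArg (fun F => GradedRing.proj 𝒜 d (aeval x F)) (sum_homogeneousComponent F)
  simp only [map_sum] at hsum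
  have hproj : GradedRing.proj 𝒜 d (aeval x F) = aeval x F := by
    rw [GradedRing.proj_apply, DirectSum.decompose_of_mem_same 𝒜 ha]
  rw [hproj] at hsum
  rw [← hsum]
  have hterm : ∀ e, GradedRing.proj 𝒜 d (aeval x (homogeneousComponent e F)) =
      if e = d then aeval x (homogeneousComponent d F) else 0 := by
    intro e
    have he := aeval_mem_of_isHomogeneous 𝒜 hx (homogeneousComponent_isHomogeneous e F)
    rw [GradedRing.proj_apply]
    split_ifs with h
    · subst h
      rw [DirectSum.decompose_of_mem_same 𝒜 he]
    · rw [DirectSum.decompose_of_mem_ne 𝒜 he h]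
  simp only [hterm, Finset.sum_ite_eq', Finset.mem_range]
  split_ifs with h
  · rfl
  · rw [homogeneousComponent_eq_zero, map_zero]
    omega

theorem algebraMap_gradeZero_surjective (hx : ∀ i, x i ∈ 𝒜 1)
    (hgen : Function.Surjective (aeval x : MvPolynomial (Fin n) R →ₐ[R] A)) :
    Function.Surjective (algebraMap R (𝒜 0)) := by
  rintro ⟨a, ha⟩
  obtain ⟨F, hF, rfl⟩ := exists_isHomogeneous_aeval_eq 𝒜 hx hgen ha
  obtain ⟨r, rfl⟩ : ∃ r, F = C r := ⟨_, totalDegree_eq_zero_iff_eq_C.mp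
    (Nat.le_zero.mp hF.totalDegree_le)⟩
  exact ⟨r, Subtype.ext (by simp)⟩

/-- The structure map from the base ring to the degree zero part of a localization. -/
noncomputable def awayAlgebraMap (f : A) : R →+* Away 𝒜 f :=
  (fromZeroRingHom 𝒜 (Submonoid.powers f)).comp (algebraMap R (𝒜 0))

theorem val_awayAlgebraMap (f : A) (r : R) :
    (awayAlgebraMap 𝒜 f r).val = algebraMap A (Localization.Away f) (algebraMap R A r) := by
  change Localization.mk _ _ = _
  rw [← Localization.mk_one_eq_algebraMap]
  rfl

theorem val_isLocalizationElem {f g : A} (hf : f ∈ 𝒜 1) (hg : g ∈ 𝒜 1) :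
    algebraMap A (Localization.Away f) f * (Away.isLocalizationElem hf hg).val =
      algebraMap A (Localization.Away f) g := by
  rw [Away.val_mk, ← Localization.mk_one_eq_algebraMap, ← Localization.mk_one_eq_algebraMap,
    Localization.mk_mul, Localization.mk_eq_mk_iff, Localization.r_iff_exists]
  exact ⟨1, by simp⟩

theorem isLocalizationElem_self {f : A} (hf : f ∈ 𝒜 1) : Away.isLocalizationElem hf hf = 1 := by
  apply HomogeneousLocalization.val_injective
  rw [HomogeneousLocalization.val_one]
  refine (IsLocalization.Away.algebraMap_isUnit (S := Localization.Away f) f).mul_left_cancel ?_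
  rw [val_isLocalizationElem, mul_one]

/-- A degree zero fraction is `F(x) / (x i)^d` with `F` a form of degree `d`, that is, `F` evaluated
at the quotients `x j / x i`. The identity is checked in the full localization after multiplication
by the unit `(x i)^d`. -/
theorem eval₂Hom_away_surjective (hx : ∀ i, x i ∈ 𝒜 1)
    (hgen : Function.Surjective (aeval x : MvPolynomial (Fin n) R →ₐ[R] A)) (i : Fin n) :
    Function.Surjective (eval₂Hom (awayAlgebraMap 𝒜 (x i))
      fun j => Away.isLocalizationElem (hx i) (hx j)) := by
  intro z
  obtain ⟨d, a, ha, rfl⟩ := Away.mk_surjective 𝒜 (hx i) z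
  obtain ⟨F, hF, rfl⟩ := exists_isHomogeneous_aeval_eq 𝒜 hx hgen ha
  refine ⟨F, HomogeneousLocalization.val_injective _ ?_⟩
  have hu := IsLocalization.Away.algebraMap_isUnit (S := Localization.Away (x i)) (x i)
  refine (hu.pow d).mul_left_cancel ?_
  have h₁ : algebraMap A (Localization.Away (x i)) (x i) ^ d *
      (Away.mk 𝒜 (hx i) d (aeval x F) ha).val =
      algebraMap A (Localization.Away (x i)) (aeval x F) := by
    rw [Away.val_mk, ← map_pow, ← Localization.mk_one_eq_algebraMap,
      ← Localization.mk_one_eq_algebraMap, Localization.mk_mul, Localization.mk_eq_mk_iff,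
      Localization.r_iff_exists]
    exact ⟨1, by simp⟩
  rw [h₁]
  change _ * algebraMap (Away 𝒜 (x i)) (Localization.Away (x i)) _ = _
  rw [aeval_eq_eval₂Hom, coe_eval₂Hom, coe_eval₂Hom, eval₂_eq', eval₂_eq', map_sum, map_sum,
    Finset.mul_sum]
  refine Finset.sum_congr rfl fun m hm => ?_
  have hdeg : ∑ j, m j = d := by
    have := hF (mem_support_iff.mp hm)
    rw [Finsupp.weight_apply, Finsupp.sum_fintype] at this <;> simp_all
  rw [map_mul, map_mul, map_prod, map_prod]
  change _ * ((awayAlgebraMap 𝒜 (x i) _).val * _) = _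
  rw [val_awayAlgebraMap, mul_left_comm, ← hdeg, ← Finset.prod_pow_eq_pow_sum,
    ← Finset.prod_mul_distrib]
  congr 1
  refine Finset.prod_congr rfl fun j _ => ?_
  rw [map_pow, map_pow, ← mul_pow, HomogeneousLocalization.algebraMap_apply,
    val_isLocalizationElem]

variable {B : Type*} [CommRing B] [Algebra R B]

/-- The map from the `i`-th chart of `Proj 𝒜` to the coordinate ring of the `i`-th cell. -/
noncomputable def cellMap (ψ : A →ₐ[R] MvPolynomial (Fin n) B) (hψ : ∀ i, ψ (x i) = X i)
    (i : Fin n) : Away 𝒜 (x i) →+* MvPolynomial {j // i < j} B :=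
  (IsLocalization.Away.lift (S := Localization.Away (x i)) (x i)
    (g := ((eval₂Hom C (cellCoord B i)).comp ψ.toRingHom))
    (by simp [hψ, cellCoord_self])).comp (algebraMap (Away 𝒜 (x i)) (Localization.Away (x i)))

variable (ψ : A →ₐ[R] MvPolynomial (Fin n) B) (hψ : ∀ i, ψ (x i) = X i)

theorem cellMap_awayAlgebraMap (i : Fin n) (r : R) :
    cellMap 𝒜 ψ hψ i (awayAlgebraMap 𝒜 (x i) r) = C (algebraMap R B r) := by
  rw [cellMap, RingHom.comp_apply, HomogeneousLocalization.algebraMap_apply, val_awayAlgebraMap,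
    IsLocalization.Away.lift_eq]
  simp [IsScalarTower.algebraMap_apply R B (MvPolynomial (Fin n) B)]

theorem cellMap_isLocalizationElem (hx : ∀ i, x i ∈ 𝒜 1) (i j : Fin n) :
    cellMap 𝒜 ψ hψ i (Away.isLocalizationElem (hx i) (hx j)) = cellCoord B i j := by
  have h := congrArg (IsLocalization.Away.lift (S := Localization.Away (x i)) (x i)
    (g := ((eval₂Hom C (cellCoord B i)).comp ψ.toRingHom)) (by simp [hψ, cellCoord_self]))
    (val_isLocalizationElem 𝒜 (hx i) (hx j))
  have hX : ∀ l, ((eval₂Hom C (cellCoord B i)).comp ψ.toRingHom) (x l) = cellCoord B i l := by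
    simp [hψ]
  rw [map_mul, IsLocalization.Away.lift_eq, IsLocalization.Away.lift_eq] at h
  refine Eq.trans ?_ (h.trans (hX j))
  conv_rhs => enter [1]; rw [hX, cellCoord_self]
  rw [one_mul]
  rfl

theorem cellMap_surjective (hx : ∀ i, x i ∈ 𝒜 1) (hB : Function.Surjective (algebraMap R B))
    (i : Fin n) : Function.Surjective (cellMap 𝒜 ψ hψ i) := by
  intro p
  induction p using MvPolynomial.induction_on with
  | C b =>
    obtain ⟨r, rfl⟩ := hB b
    exact ⟨_, cellMap_awayAlgebraMap 𝒜 ψ hψ i r⟩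
  | add p q hp hq =>
    obtain ⟨a, rfl⟩ := hp
    obtain ⟨b, rfl⟩ := hq
    exact ⟨a + b, map_add _ _ _⟩
  | mul_X p j hp =>
    obtain ⟨a, rfl⟩ := hp
    refine ⟨a * Away.isLocalizationElem (hx i) (hx j), ?_⟩
    rw [map_mul, cellMap_isLocalizationElem, cellCoord, dif_pos j.2]

theorem ker_cellMap_le (hx : ∀ i, x i ∈ 𝒜 1)
    (hgen : Function.Surjective (aeval x : MvPolynomial (Fin n) R →ₐ[R] A)) (i : Fin n)
    (q : Ideal (Away 𝒜 (x i)))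
    (hq : ∀ r, algebraMap R B r = 0 → awayAlgebraMap 𝒜 (x i) r ∈ q)
    (hqx : ∀ j < i, Away.isLocalizationElem (hx i) (hx j) ∈ q) :
    RingHom.ker (cellMap 𝒜 ψ hψ i) ≤ q :=
  ker_le_of_cell (algebraMap R B) _ i _ (isLocalizationElem_self 𝒜 (hx i))
    (eval₂Hom_away_surjective 𝒜 hx hgen i) _ (cellMap_awayAlgebraMap 𝒜 ψ hψ i)
    (cellMap_isLocalizationElem 𝒜 ψ hψ hx i) q hq hqx

end graded

/-! ### The fibre class of `Proj` of a polynomial ring -/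

section proj

open MvPolynomial HomogeneousLocalization

theorem HasFiberClass.mvPolynomial_zero {k : Type u} [Field k] (σ : Type) [Finite σ]
    (B : Type u) [CommRing B] :
    HasFiberClass (Spec.map (CommRingCat.ofHom (algebraMap B (MvPolynomial σ B))))
      (K0Var.lefschetz k ^ Nat.card σ) := by
  have h := HasFiberClass.mvPolynomial (k := k) (ULift.{u} σ) B
  rw [Nat.card_congr Equiv.ulift] at h
  exact HasFiberClass.of_algEquiv (MvPolynomial.renameEquiv B Equiv.ulift) h

variable {R A : Type u} [CommRing R] [CommRing A] [Algebra R A] (𝒜 : ℕ → Submodule R A)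
  [GradedAlgebra 𝒜] {n : ℕ} {x : Fin n → A}

theorem projToSpec_finiteType (hx : ∀ i, x i ∈ 𝒜 1)
    (hgen : Function.Surjective (aeval x : MvPolynomial (Fin n) R →ₐ[R] A)) :
    LocallyOfFiniteType (projToSpec 𝒜) ∧ QuasiCompact (projToSpec 𝒜) := by
  have : IsClosedImmersion (Spec.map (CommRingCat.ofHom (algebraMap R (𝒜 0)))) :=
    IsClosedImmersion.spec_of_surjective _ (algebraMap_gradeZero_surjective 𝒜 hx hgen)
  have : IsScalarTower R (𝒜 0) A := ⟨fun a b c => smul_mul_assoc a (b : A) c⟩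
  have : Algebra.FiniteType R A := Algebra.FiniteType.of_surjective _ hgen
  have : Algebra.FiniteType (𝒜 0) A := Algebra.FiniteType.of_restrictScalars_finiteType R _ _
  dsimp [projToSpec]
  exact ⟨inferInstance, inferInstance⟩

theorem awayι_projToSpec {f : A} (hf : f ∈ 𝒜 1) :
    Proj.awayι 𝒜 f hf one_pos ≫ projToSpec 𝒜 =
      Spec.map (CommRingCat.ofHom (awayAlgebraMap 𝒜 f)) := by
  rw [projToSpec, Proj.awayι_toSpecZero_assoc, ← Spec.map_comp]
  rfl

theorem iSup_basicOpen_of_aeval_surjective (hx : ∀ i, x i ∈ 𝒜 1)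
    (hgen : Function.Surjective (aeval x : MvPolynomial (Fin n) R →ₐ[R] A)) :
    ⨆ i, Proj.basicOpen 𝒜 (x i) = ⊤ := by
  refine Proj.iSup_basicOpen_eq_top' 𝒜 x (fun i => ⟨1, hx i⟩) ?_
  rw [eq_top_iff]
  have : IsScalarTower R (𝒜 0) A := ⟨fun a b c => smul_mul_assoc a (b : A) c⟩
  have h : (⊤ : Subalgebra R A) ≤ (Algebra.adjoin (𝒜 0) (Set.range x)).restrictScalars R := by
    have h₁ : (aeval x : MvPolynomial (Fin n) R →ₐ[R] A).range = ⊤ :=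
      (AlgHom.range_eq_top _).mpr hgen
    rw [← h₁, ← Algebra.adjoin_range_eq_range_aeval, Algebra.adjoin_le_iff]
    exact Algebra.subset_adjoin
  exact fun a _ => h (Algebra.mem_top (R := R) (x := a))

variable {B : Type u} [CommRing B] [Algebra R B]

/-- The inclusion of the `i`-th cell. -/
noncomputable def cellι (ψ : A →ₐ[R] MvPolynomial (Fin n) B) (hψ : ∀ i, ψ (x i) = X i)
    (hx : ∀ i, x i ∈ 𝒜 1) (i : Fin n) :
    Spec (CommRingCat.of (MvPolynomial {j // i < j} B)) ⟶
      pullback (projToSpec 𝒜) (Spec.map (CommRingCat.ofHom (algebraMap R B))) :=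
  pullback.lift (Spec.map (CommRingCat.ofHom (cellMap 𝒜 ψ hψ i)) ≫
      Proj.awayι 𝒜 (x i) (hx i) one_pos)
    (Spec.map (CommRingCat.ofHom (algebraMap B _))) (by
      rw [Category.assoc, awayι_projToSpec, ← Spec.map_comp, ← Spec.map_comp]
      congr 1
      exact CommRingCat.hom_ext (RingHom.ext (cellMap_awayAlgebraMap 𝒜 ψ hψ i)))

/-- The hypotheses say that the pullback is `ℙ^{n-1}` over `Spec B`. It is partitioned according to
the first `i` with `x i ≠ 0`; the `i`-th stratum is an affine space over `B` whose coordinates are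
the `x j / x i` with `i < j`. -/
theorem HasFiberClass.proj {k : Type u} [Field k] (hx : ∀ i, x i ∈ 𝒜 1)
    (hgen : Function.Surjective (aeval x : MvPolynomial (Fin n) R →ₐ[R] A))
    (hB : Function.Surjective (algebraMap R B))
    (ψ : A →ₐ[R] MvPolynomial (Fin n) B) (hψ : ∀ i, ψ (x i) = X i) :
    HasFiberClass (pullback.snd (projToSpec 𝒜) (Spec.map (CommRingCat.ofHom (algebraMap R B))))
      (∑ i : Fin n, K0Var.lefschetz k ^ (i : ℕ)) := by
  obtain ⟨_, _⟩ := projToSpec_finiteType 𝒜 hx hgen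
  have hclosed : IsClosedImmersion (Spec.map (CommRingCat.ofHom (algebraMap R B))) :=
    IsClosedImmersion.spec_of_surjective _ hB
  have hclosed' : ∀ i, IsClosedImmersion (Spec.map (CommRingCat.ofHom (cellMap 𝒜 ψ hψ i))) :=
    fun i => IsClosedImmersion.spec_of_surjective _ (cellMap_surjective 𝒜 ψ hψ hx hB i)
  have hfst : ∀ i, cellι 𝒜 ψ hψ hx i ≫ pullback.fst _ _ =
      Spec.map (CommRingCat.ofHom (cellMap 𝒜 ψ hψ i)) ≫ Proj.awayι 𝒜 (x i) (hx i) one_pos :=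
    fun i => pullback.lift_fst _ _ _
  have himm : ∀ i, IsImmersion (cellι 𝒜 ψ hψ hx i) := fun i => by
    have : IsImmersion (cellι 𝒜 ψ hψ hx i ≫ pullback.fst _ _) := by
      rw [hfst]
      infer_instance
    exact IsImmersion.of_comp _ (pullback.fst _ _)
  have hsum : ∑ i : Fin n, K0Var.lefschetz k ^ (i : ℕ) =
      ∑ i : Fin n, K0Var.lefschetz k ^ Nat.card {j // i < j} := by
    -- The `i`-th cell has `n - 1 - i` coordinates, so the two sums agree in reverse order.
    rw [← Equiv.sum_comp Fin.revPerm]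
    refine Finset.sum_congr rfl fun i _ => ?_
    congr 1
    rw [Nat.card_eq_fintype_card, Fintype.card_subtype, Finset.filter_lt_eq_Ioi, Fin.card_Ioi]
    simp [Fin.val_rev]
    omega
  rw [hsum]
  refine HasFiberClass.of_pieces (cellι 𝒜 ψ hψ hx) ?_ fun i => ?_
  · intro z
    let fst := pullback.fst (projToSpec 𝒜) (Spec.map (CommRingCat.ofHom (algebraMap R B)))
    have hmem : ∀ i, z ∈ Set.range (cellι 𝒜 ψ hψ hx i) ↔
        fst z ∈ Proj.basicOpen 𝒜 (x i) ∧ ∀ j < i, fst z ∉ Proj.basicOpen 𝒜 (x j) := by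
      intro i
      have hrange : Set.range (Proj.awayι 𝒜 (x i) (hx i) one_pos) = Proj.basicOpen 𝒜 (x i) :=
        congrArg SetLike.coe (Proj.opensRange_awayι 𝒜 (x i) (hx i) one_pos)
      have hpre : ∀ (q : Spec (CommRingCat.of (Away 𝒜 (x i)))) j,
          Proj.awayι 𝒜 (x i) (hx i) one_pos q ∈ Proj.basicOpen 𝒜 (x j) ↔
            Away.isLocalizationElem (hx i) (hx j) ∉ q.asIdeal := fun q j => by
        have h := Proj.awayι_preimage_basicOpen 𝒜 (hx i) one_pos (hx j) one_pos
        exact iff_of_eq (congrArg (fun U : (Spec (CommRingCat.of (Away 𝒜 (x i)))).Opens => q ∈ U) h)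
      constructor
      · rintro ⟨w, rfl⟩
        have hw : fst (cellι 𝒜 ψ hψ hx i w) = Proj.awayι 𝒜 (x i) (hx i) one_pos
            (Spec.map (CommRingCat.ofHom (cellMap 𝒜 ψ hψ i)) w) := by
          rw [← Scheme.Hom.comp_apply, hfst, Scheme.Hom.comp_apply]
        rw [hw]
        refine ⟨?_, fun j hj => ?_⟩
        · rw [← SetLike.mem_coe, ← hrange]
          exact ⟨_, rfl⟩
        · rw [hpre, not_not]
          change cellMap 𝒜 ψ hψ i _ ∈ w.asIdeal
          rw [cellMap_isLocalizationElem, cellCoord_of_lt B hj]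
          exact zero_mem _
      · rintro ⟨hzi, hzj⟩
        rw [← SetLike.mem_coe, ← hrange] at hzi
        obtain ⟨q, hq⟩ := hzi
        -- The prime `q` contains the kernel of `R → B` because its image comes from `Spec B`, and
        -- the `x j / x i` with `j < i` because these sections vanish at `z`; these elements control
        -- the kernel of the cell map.
        have hker : RingHom.ker (cellMap 𝒜 ψ hψ i) ≤ q.asIdeal := by
          refine ker_cellMap_le 𝒜 ψ hψ hx hgen i _ (fun r hr => ?_) fun j hj => ?_
          · have h : Spec.map (CommRingCat.ofHom (awayAlgebraMap 𝒜 (x i))) q =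
                Spec.map (CommRingCat.ofHom (algebraMap R B))
                  (pullback.snd (projToSpec 𝒜) (Spec.map (CommRingCat.ofHom (algebraMap R B))) z) := by
              rw [← awayι_projToSpec 𝒜 (hx i), Scheme.Hom.comp_apply, hq,
                ← Scheme.Hom.comp_apply, ← Scheme.Hom.comp_apply, pullback.condition]
            have h' : r ∈ (Spec.map (CommRingCat.ofHom (algebraMap R B))
                (pullback.snd (projToSpec 𝒜) (Spec.map (CommRingCat.ofHom (algebraMap R B))) z)).asIdeal := by
              change algebraMap R B r ∈ (pullback.snd (projToSpec 𝒜)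
                (Spec.map (CommRingCat.ofHom (algebraMap R B))) z).asIdeal
              rw [hr]
              exact zero_mem _
            rw [← h] at h'
            exact h'
          · have := hzj j hj
            rwa [← hq, hpre, not_not] at this
        obtain ⟨w, hw⟩ : q ∈ Set.range (Spec.map (CommRingCat.ofHom (cellMap 𝒜 ψ hψ i))) := by
          have h := range_comap_of_surjective _ (cellMap 𝒜 ψ hψ i)
            (cellMap_surjective 𝒜 ψ hψ hx hB i)
          exact h.ge hker
        -- As `B` is a quotient of `R`, the first projection is a closed immersion, so points may be
        -- compared in `Proj 𝒜`.
        refine ⟨w, (pullback.fst (projToSpec 𝒜) (Spec.map (CommRingCat.ofHom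
          (algebraMap R B)))).isClosedEmbedding.injective ?_⟩
        rw [← Scheme.Hom.comp_apply, hfst, Scheme.Hom.comp_apply, hw, hq]
    simp only [hmem]
    have hex : ∃ i, fst z ∈ Proj.basicOpen 𝒜 (x i) := by
      have : fst z ∈ ⨆ i, Proj.basicOpen 𝒜 (x i) := by
        rw [iSup_basicOpen_of_aeval_surjective 𝒜 hx hgen]
        trivial
      exact TopologicalSpace.Opens.mem_iSup.mp this
    obtain ⟨i, hi, hmin⟩ := WellFounded.has_min (wellFounded_lt (α := Fin n))
      {i | fst z ∈ Proj.basicOpen 𝒜 (x i)} hex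
    refine ⟨i, ⟨hi, fun j hj h => hmin j h hj⟩, fun j ⟨hj, hjmin⟩ => ?_⟩
    rcases lt_trichotomy i j with h | h | h
    · exact absurd hi (hjmin i h)
    · exact h.symm
    · exact absurd h (hmin j hj)
  · rw [cellι, pullback.lift_snd]
    exact HasFiberClass.mvPolynomial_zero _ _

end proj

/-! ### Projective spaces and Rees algebras -/

section applications

open MvPolynomial

variable {k : Type u} [Field k]

theorem K0Var.classOf_projOfVars (n : ℕ) :
    classOf (projOfVars k n).hom = ∑ i : Fin n, lefschetz k ^ (i : ℕ) := by
  have h := HasFiberClass.proj (k := k) (B := k) (homogeneousSubmodule (Fin n) k)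
    (x := (X : Fin n → MvPolynomial (Fin n) k)) (fun i => isHomogeneous_X k i)
    (fun p => ⟨p, by simp⟩) (fun r => ⟨r, rfl⟩) (AlgHom.id k _) (fun i => rfl)
  have h' : Spec.map (CommRingCat.ofHom (algebraMap k k)) = 𝟙 _ := by
    rw [← Spec.map_id]
    rfl
  rw [h'] at h
  have := h.classOf_comp (𝟙 (Spec (CommRingCat.of k)))
  rw [classOf_id, one_mul, Category.comp_id] at this
  rw [← this, ← Category.comp_id (pullback.snd _ _), ← pullback.condition]
  exact (classOf_iso (pullback.fst (projToSpec (homogeneousSubmodule (Fin n) k)) (𝟙 _)) _).symm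

theorem K0Var.projClass_eq (m : ℤ) :
    projClass k m = ∑ i : Fin (m + 1).toNat, lefschetz k ^ (i : ℕ) := by
  rw [projClass, cls_eq_classOf, classOf_projOfVars]

variable {A : Type u} [CommRing A] {I : Ideal A} {n : ℕ}

/-- The element `f t` of degree one of the Rees algebra. -/
noncomputable def reesMonomial (f : I) : reesAlgebra I :=
  ⟨Polynomial.monomial 1 (f : A), reesAlgebra.monomial_mem.mpr (by simp)⟩

theorem reesMonomial_mem (f : I) : reesMonomial f ∈ reesGrading I 1 := ⟨_, rfl⟩

theorem aeval_reesMonomial_surjective (f : Fin n → I)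
    (hf : I ≤ Ideal.span (Set.range fun i => (f i : A))) :
    Function.Surjective (aeval fun i => reesMonomial (f i) :
      MvPolynomial (Fin n) A →ₐ[A] reesAlgebra I) := by
  let S := ((aeval fun i => reesMonomial (f i) :
      MvPolynomial (Fin n) A →ₐ[A] reesAlgebra I).range).map (reesAlgebra I).val
  have hI : I ≤ (Subalgebra.toSubmodule S).comap (Polynomial.monomial 1) := by
    refine hf.trans (Submodule.span_le.mpr ?_)
    rintro _ ⟨i, rfl⟩
    exact ⟨reesMonomial (f i), ⟨X i, by simp⟩, rfl⟩
  have h : reesAlgebra I ≤ S := by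
    refine (adjoin_monomial_eq_reesAlgebra I).ge.trans (Algebra.adjoin_le ?_)
    rintro _ ⟨a, ha, rfl⟩
    exact hI ha
  intro p
  obtain ⟨q, hq, hqp⟩ := h p.2
  rw [← Subtype.ext hqp]
  exact hq

theorem aeval_monomial_of_isHomogeneous (f : Fin n → A) {F : MvPolynomial (Fin n) A} {d : ℕ}
    (hF : F.IsHomogeneous d) :
    aeval (fun i => Polynomial.monomial 1 (f i)) F = Polynomial.monomial d (aeval f F) := by
  rw [aeval_eq_eval₂Hom, aeval_eq_eval₂Hom, coe_eval₂Hom, coe_eval₂Hom, eval₂_eq', eval₂_eq',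
    map_sum]
  refine Finset.sum_congr rfl fun m hm => ?_
  have hdeg : ∑ j, m j = d := by
    have := hF (mem_support_iff.mp hm)
    rw [Finsupp.weight_apply, Finsupp.sum_fintype] at this <;> simp_all
  rw [← hdeg]
  simp_rw [← Polynomial.C_mul_X_pow_eq_monomial, pow_one, mul_pow, Finset.prod_mul_distrib,
    Finset.prod_pow_eq_pow_sum, map_mul, map_prod, map_pow, ← mul_assoc]
  rfl

/-- The value of `F` at the elements `f i · t` is `∑ F_d(f) t^d`, so a relation holds degree by
degree. -/
theorem aeval_homogeneousComponent_eq_zero (f : Fin n → A) {F : MvPolynomial (Fin n) A}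
    (hF : aeval (fun i => Polynomial.monomial 1 (f i)) F = 0) (d : ℕ) :
    aeval f (homogeneousComponent d F) = 0 := by
  rw [← sum_homogeneousComponent F, map_sum] at hF
  have h := congrArg (fun p => Polynomial.coeff p d) hF
  simp only [aeval_monomial_of_isHomogeneous f (homogeneousComponent_isHomogeneous _ F),
    Polynomial.finsetSum_coeff, Polynomial.coeff_monomial, Finset.sum_ite_eq',
    Polynomial.coeff_zero, Finset.mem_range] at h
  split_ifs at h with hd
  · exact h
  · rw [homogeneousComponent_eq_zero, map_zero]
    omega

/-- By `hind`, relations among the generators of the Rees algebra vanish modulo `I`. Hence reduction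
of coefficients descends to a map from the Rees algebra to `(A ⧸ I)[X]`, as required by
`HasFiberClass.proj`: the part of the blow-up over the center is a projective space over it. -/
theorem HasFiberClass.rees (f : Fin n → I)
    (hf : I ≤ Ideal.span (Set.range fun i => (f i : A)))
    (hind : ∀ d (F : MvPolynomial (Fin n) A), F.IsHomogeneous d →
      aeval (fun i => (f i : A)) F = 0 → map (Ideal.Quotient.mk I) F = 0) :
    HasFiberClass (pullback.snd (projToSpec (reesGrading I))
      (Spec.map (CommRingCat.ofHom (algebraMap A (A ⧸ I)))))
      (∑ i : Fin n, K0Var.lefschetz k ^ (i : ℕ)) := by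
  have hsurj := aeval_reesMonomial_surjective f hf
  let g : MvPolynomial (Fin n) A →ₐ[A] MvPolynomial (Fin n) (A ⧸ I) :=
    MvPolynomial.mapAlgHom (Ideal.Quotient.mkₐ A I)
  have hker : ∀ F, aeval (fun i => reesMonomial (f i)) F = 0 → g F = 0 := by
    intro F hF
    rw [← sum_homogeneousComponent F, map_sum]
    refine Finset.sum_eq_zero fun d _ => hind d _ (homogeneousComponent_isHomogeneous _ _) ?_
    refine aeval_homogeneousComponent_eq_zero _ ?_ d
    have h := congrArg (reesAlgebra I).val hF
    rw [← AlgHom.comp_apply, MvPolynomial.comp_aeval, map_zero] at h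
    exact h
  refine HasFiberClass.proj (reesGrading I) (fun i => reesMonomial_mem (f i)) hsurj
    Ideal.Quotient.mk_surjective (AlgHom.liftOfSurjective _ hsurj g hker) fun i => ?_
  have h := AlgHom.liftOfSurjective_apply _ hsurj g hker (X i)
  rw [aeval_X] at h
  rw [h]
  exact map_X _ i

/-- The unit ideal is generated by the single element `1`, so this is the case of `ℙ⁰`. It describes
the blow-up away from the center. -/
theorem HasFiberClass.rees_top (hI : I = ⊤) :
    HasFiberClass (projToSpec (reesGrading I)) (1 : K0Var k) := by
  subst hI
  let f : Fin 1 → (⊤ : Ideal A) := fun _ => ⟨1, trivial⟩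
  have hsurj := aeval_reesMonomial_surjective f (by simp [f])
  have h := HasFiberClass.proj (k := k) (B := A) (reesGrading (⊤ : Ideal A))
    (fun i => reesMonomial_mem (f i)) hsurj (fun r => ⟨r, rfl⟩)
    ((Polynomial.aeval (X 0)).comp (reesAlgebra ⊤).val) (fun i => by
      fin_cases i
      simp [f, reesMonomial])
  have h' : Spec.map (CommRingCat.ofHom (algebraMap A A)) = 𝟙 _ := by
    rw [← Spec.map_id]
    rfl
  rw [h', Fin.sum_univ_one, Fin.val_zero, pow_zero] at h
  have h'' := h.iso_comp (inv (pullback.fst (projToSpec (reesGrading (⊤ : Ideal A))) (𝟙 _)))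
  rwa [← Category.comp_id (pullback.snd _ _), ← pullback.condition, IsIso.inv_hom_id_assoc] at h''

end applications

/-! ### Quasi-regular sequences -/

section quasiRegular

open MvPolynomial

/-- The sequence `f` generates the ideal `I` and is quasi-regular: a form in `f` of degree `d` lies
in `I ^ (d + 1)` only if its coefficients lie in `I`. -/
structure QuasiRegular {A : Type*} [CommRing A] (I : Ideal A) {r : ℕ} (f : Fin r → A) : Prop where
  span_eq : Ideal.span (Set.range f) = I
  coeff_mem : ∀ (d : ℕ) (F : MvPolynomial (Fin r) A), F.IsHomogeneous d →
    aeval f F ∈ I ^ (d + 1) → ∀ m, coeff m F ∈ I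

/-- Two elements of `M ^ d` that agree modulo `M ^ (d + 1)`. -/
structure LeadingEq {Q : Type*} [CommRing Q] (M : Ideal Q) (d : ℕ) (u v : Q) : Prop where
  left : u ∈ M ^ d
  right : v ∈ M ^ d
  sub : u - v ∈ M ^ (d + 1)

namespace LeadingEq

variable {Q : Type*} [CommRing Q] {M : Ideal Q}

theorem one : LeadingEq M 0 1 1 := ⟨by simp, by simp, by simp⟩

theorem mul {d e : ℕ} {u v u' v' : Q} (h : LeadingEq M d u v) (h' : LeadingEq M e u' v') :
    LeadingEq M (d + e) (u * u') (v * v') where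
  left := by rw [pow_add]; exact Ideal.mul_mem_mul h.left h'.left
  right := by rw [pow_add]; exact Ideal.mul_mem_mul h.right h'.right
  sub := by
    have h₁ : u * u' - v * v' = u * (u' - v') + (u - v) * v' := by ring
    rw [h₁]
    refine Ideal.add_mem _ ?_ ?_
    · rw [add_assoc, pow_add]
      exact Ideal.mul_mem_mul h.left h'.sub
    · rw [add_right_comm, pow_add]
      exact Ideal.mul_mem_mul h.sub h'.right

theorem pow {u v : Q} (h : LeadingEq M 1 u v) (n : ℕ) : LeadingEq M n (u ^ n) (v ^ n) := by
  induction n with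
  | zero => simpa using one
  | succ n ih => simpa only [pow_succ] using ih.mul h

theorem prod {ι : Type*} (s : Finset ι) {u v : ι → Q} {e : ι → ℕ}
    (h : ∀ i, LeadingEq M (e i) (u i) (v i)) :
    LeadingEq M (∑ i ∈ s, e i) (∏ i ∈ s, u i) (∏ i ∈ s, v i) := by
  classical
  induction s using Finset.induction_on with
  | empty => simpa using one
  | insert a s ha ih =>
    rw [Finset.sum_insert ha, Finset.prod_insert ha, Finset.prod_insert ha]
    exact (h a).mul ih

theorem eval₂_sub_mem {A : Type*} [CommRing A] {r d : ℕ} (α β : A →+* Q)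
    (hαβ : ∀ a, α a - β a ∈ M) {u v : Fin r → Q} (h : ∀ i, LeadingEq M 1 (u i) (v i))
    {F : MvPolynomial (Fin r) A} (hF : F.IsHomogeneous d) :
    eval₂ α u F - eval₂ β v F ∈ M ^ (d + 1) := by
  rw [eval₂_eq', eval₂_eq', ← Finset.sum_sub_distrib]
  refine Ideal.sum_mem _ fun m hm => ?_
  have hdeg : ∑ j, m j = d := by
    have := hF (mem_support_iff.mp hm)
    rw [Finsupp.weight_apply, Finsupp.sum_fintype] at this <;> simp_all
  have h₀ : LeadingEq M 0 (α (coeff m F)) (β (coeff m F)) := ⟨by simp, by simp, by simpa using hαβ _⟩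
  have := h₀.mul (prod Finset.univ fun i => (h i).pow (m i))
  rw [hdeg, zero_add] at this
  exact this.sub

end LeadingEq

/-- The first order deformation of an algebra homomorphism along derivations. -/
noncomputable def derivationHom {K A B Q : Type*} [CommRing K] [CommRing A] [CommRing B]
    [CommRing Q] [Algebra K A] [Algebra K B] [Algebra K Q] [Algebra A B] [IsScalarTower K A B]
    {r : ℕ} (δ : Fin r → Derivation K A B) (β : B →ₐ[K] Q) (T : Fin r → Q) (M : Ideal Q)
    (hT : ∀ i, T i ∈ M) : A →ₐ[K] Q ⧸ M ^ 2 :=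
  AlgHom.ofLinearMap ((Ideal.Quotient.mkₐ K (M ^ 2)).toLinearMap ∘ₗ
    (β.toLinearMap ∘ₗ (IsScalarTower.toAlgHom K A B).toLinearMap +
      ∑ i, (LinearMap.mulRight K (T i)) ∘ₗ β.toLinearMap ∘ₗ (δ i : A →ₗ[K] B)))
    (by simp) (fun a b => by
      rw [LinearMap.comp_apply, LinearMap.comp_apply, LinearMap.comp_apply,
        AlgHom.toLinearMap_apply, AlgHom.toLinearMap_apply, AlgHom.toLinearMap_apply, ← map_mul,
        Ideal.Quotient.mkₐ_eq_mk, Ideal.Quotient.mk_eq_mk_iff_sub_mem]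
      simp only [LinearMap.comp_apply, LinearMap.add_apply, LinearMap.sum_apply,
        AlgHom.toLinearMap_apply, LinearMap.mulRight_apply, Derivation.coeFn_coe,
        Derivation.leibniz, IsScalarTower.coe_toAlgHom', map_mul, map_add, Algebra.smul_def]
      -- By the Leibniz rule the failure of multiplicativity is, up to sign, the product of the two
      -- first order terms, which lies in `M ^ 2`.
      have h : (∑ i, β (δ i a) * T i) * (∑ i, β (δ i b) * T i) ∈ M ^ 2 := by
        rw [pow_two]
        exact Ideal.mul_mem_mul (Ideal.sum_mem _ fun i _ => Ideal.mul_mem_left _ _ (hT i))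
          (Ideal.sum_mem _ fun i _ => Ideal.mul_mem_left _ _ (hT i))
      rw [← Ideal.neg_mem_iff] at h
      convert h using 1
      simp only [add_mul, Finset.sum_add_distrib, mul_assoc, ← Finset.mul_sum, mul_add,
        Finset.sum_mul]
      simp only [mul_left_comm _ (β (algebraMap A B b)), mul_comm _ (β (algebraMap A B b)),
        ← Finset.mul_sum]
      ring)

/-- The derivations give a first order Taylor expansion sending `f i` to `X i`. It lifts to `Φ` with
values in a truncation of `B[X]`, by formal smoothness. Then `Φ` of the value of `F` at `f` agrees
with the reduction of `F` modulo degree `d + 1`, and also lies in degree at least `d + 1` by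
hypothesis; so the reduction of `F`, a form of degree `d`, is zero. -/
theorem coeff_mem_ker_of_derivation {K A B : Type*} [CommRing K] [CommRing A] [CommRing B]
    [Algebra K A] [Algebra K B] [Algebra A B] [IsScalarTower K A B] [Algebra.FormallySmooth K A]
    {r : ℕ} (f : Fin r → A) (hf : ∀ i, algebraMap A B (f i) = 0) (δ : Fin r → Derivation K A B)
    (hδ : ∀ i j, δ i (f j) = if i = j then 1 else 0) (d : ℕ) (F : MvPolynomial (Fin r) A)
    (hF : F.IsHomogeneous d) (h : aeval f F ∈ RingHom.ker (algebraMap A B) ^ (d + 1))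
    (m : Fin r →₀ ℕ) : coeff m F ∈ RingHom.ker (algebraMap A B) := by
  let m₀ := idealOfVars (Fin r) B
  let Q := MvPolynomial (Fin r) B ⧸ m₀ ^ (d + 2)
  let π : MvPolynomial (Fin r) B →ₐ[K] Q := Ideal.Quotient.mkₐ K _
  let M : Ideal Q := m₀.map π
  have hMpow : M ^ (d + 2) = ⊥ := by
    rw [← Ideal.map_pow, Ideal.map_eq_bot_iff_le_ker]
    intro p hp
    exact Ideal.Quotient.eq_zero_iff_mem.mpr hp
  let T : Fin r → Q := fun i => π (X i)
  have hT : ∀ i, T i ∈ M := fun i => Ideal.mem_map_of_mem _ (Ideal.subset_span ⟨i, rfl⟩)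
  let β : B →ₐ[K] Q := π.comp (IsScalarTower.toAlgHom K B (MvPolynomial (Fin r) B))
  -- Truncating the polynomial ring makes `M`, hence `M ^ 2`, nilpotent, as the lifting property
  -- demands.
  obtain ⟨Φ, hΦ⟩ := Algebra.FormallySmooth.exists_lift (M ^ 2)
    ⟨d + 2, by rw [← pow_mul, mul_comm, pow_mul, hMpow, Ideal.zero_eq_bot, ← Ideal.zero_eq_bot,
      zero_pow two_ne_zero]⟩ (derivationHom δ β T M hT)
  have hΦ' : ∀ a, Φ a - (β (algebraMap A B a) + ∑ i, β (δ i a) * T i) ∈ M ^ 2 := fun a => by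
    rw [← Ideal.Quotient.mk_eq_mk_iff_sub_mem]
    simpa [derivationHom] using DFunLike.congr_fun hΦ a
  have hΦM : ∀ a, Φ a - β (algebraMap A B a) ∈ M := fun a => by
    have h₁ := Ideal.pow_le_self two_ne_zero (hΦ' a)
    have h₂ : ∑ i, β (δ i a) * T i ∈ M := Ideal.sum_mem _ fun i _ => Ideal.mul_mem_left _ _ (hT i)
    convert Ideal.add_mem _ h₁ h₂ using 1
    ring
  have hΦf : ∀ i, LeadingEq M 1 (Φ (f i)) (T i) := fun i => by
    refine ⟨?_, by simpa using hT i, ?_⟩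
    · simpa [hf] using hΦM (f i)
    · simpa [hf, hδ] using hΦ' (f i)
  have h₁ := LeadingEq.eval₂_sub_mem (Φ : A →+* Q) ((β : B →+* Q).comp (algebraMap A B))
    hΦM hΦf hF
  have h₂ : eval₂ (Φ : A →+* Q) (fun i => Φ (f i)) F ∈ M ^ (d + 1) := by
    have h₃ : eval₂ (Φ : A →+* Q) (fun i => Φ (f i)) F = Φ (aeval f F) := by
      have := map_aeval f (Φ : A →+* Q) F
      simpa using this.symm
    have h₄ : RingHom.ker (algebraMap A B) ≤ M.comap Φ := fun a ha => by
      have := hΦM a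
      rw [RingHom.mem_ker.mp ha] at this
      simpa using this
    rw [h₃]
    exact Ideal.le_comap_pow _ _ (Ideal.pow_right_mono h₄ _ h)
  have h₃ : eval₂ ((β : B →+* Q).comp (algebraMap A B)) T F = π (map (algebraMap A B) F) := by
    rw [← eval₂_map]
    have h₄ := hom_eval₂ (map (algebraMap A B) F) C (π : MvPolynomial (Fin r) B →+* Q) X
    rw [eval₂_eta] at h₄
    exact h₄.symm
  have h₄ : π (map (algebraMap A B) F) ∈ M ^ (d + 1) := by
    rw [← h₃]
    exact (Submodule.sub_mem_iff_right _ h₂).mp h₁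
  have h₅ : map (algebraMap A B) F ∈ m₀ ^ (d + 1) := by
    rw [← Ideal.map_pow] at h₄
    obtain ⟨q, hq, hqp⟩ := (Ideal.mem_map_iff_of_surjective π
      (Ideal.Quotient.mkₐ_surjective K _)).mp h₄
    have h₆ := Ideal.Quotient.eq.mp hqp
    rw [← Submodule.sub_mem_iff_right _ hq]
    exact Ideal.pow_le_pow_right (by omega) h₆
  rw [RingHom.mem_ker, ← coeff_map]
  by_cases hm : m.degree = d
  · exact (mem_pow_idealOfVars_iff' _ _).mp h₅ m (by omega)
  · exact (hF.map _).coeff_eq_zero hm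

end quasiRegular

/-! ### Local generators of the ideal of a smooth center -/

/-- At the prime `p` the module becomes free, with a basis coming from `C`. Clearing denominators in
the dual basis and in the two identities leaves a single factor `s` outside `p`. -/
theorem exists_dual_family {B C : Type u} [CommRing B] [AddCommGroup C] [Module B C]
    [Module.FinitePresentation B C] [Module.Flat B C] (p : Ideal B) [p.IsPrime] :
    ∃ (r : ℕ) (c : Fin r → C) (h : C →ₗ[B] Fin r → B), ∃ s ∉ p,
      (∀ i j, h (c j) i = if i = j then s else 0) ∧
      ∀ x : C, s • x = ∑ i, h x i • c i := by
  classical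
  let S := p.primeCompl
  let μ := LocalizedModule.mkLinearMap S C
  have hspan : Submodule.span (Localization S) (Set.range μ) = ⊤ := by
    rw [← Set.image_univ]
    exact span_eq_top_of_isLocalizedModule _ S μ (by simp)
  obtain ⟨κ, a, b, hb⟩ := Module.exists_basis_of_span_of_flat (R := Localization S) μ hspan
  have : Finite κ := Module.Finite.finite_basis b
  let e := Finite.equivFin κ
  let b' := b.reindex e
  let c : Fin (Nat.card κ) → C := a ∘ e.symm
  have hb' : ∀ i, b' i = μ (c i) := fun i => by simp [b', c, hb]
  let ν : (Fin (Nat.card κ) → B) →ₗ[B] Fin (Nat.card κ) → Localization S :=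
    LinearMap.pi fun i => Algebra.linearMap B (Localization S) ∘ₗ LinearMap.proj i
  have : IsLocalizedModule S ν := inferInstance
  obtain ⟨h, s, hs⟩ := Module.FinitePresentation.exists_lift_of_isLocalizedModule S ν
    ((b'.equivFun.toLinearMap.restrictScalars B) ∘ₗ μ)
  have hs' : ∀ x i, algebraMap B (Localization S) (h x i) = s.1 • b'.repr (μ x) i := fun x i =>
    congrFun (DFunLike.congr_fun hs x) i
  obtain ⟨t, ht⟩ := Module.Finite.exists_smul_of_comp_eq_of_isLocalizedModule S μ
    (s.1 • LinearMap.id) (∑ i, (LinearMap.toSpanSingleton B C (c i)) ∘ₗ LinearMap.proj i ∘ₗ h) <| by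
    ext x
    simp only [LinearMap.comp_apply, LinearMap.smul_apply, LinearMap.id_apply, map_smul,
      LinearMap.sum_apply, map_sum, LinearMap.toSpanSingleton_apply, LinearMap.proj_apply]
    conv_lhs => rw [← b'.sum_repr (μ x), Finset.smul_sum]
    refine Finset.sum_congr rfl fun i _ => ?_
    rw [hb', ← algebraMap_smul (Localization S) (h x i), hs', smul_assoc]
  have hd : ∀ i j, ∃ t : S, t • h (c j) i = t • if i = j then s.1 else 0 := fun i j => by
    refine (IsLocalizedModule.exists_of_eq (S := S) (f := Algebra.linearMap B (Localization S)) ?_)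
    rw [Algebra.linearMap_apply, hs', ← hb', b'.repr_self, Finsupp.single_apply,
      Algebra.linearMap_apply]
    simp only [eq_comm (a := i), apply_ite (algebraMap B (Localization S)), map_zero]
    split_ifs <;> simp [Algebra.smul_def]
  choose t' ht' using hd
  -- A common multiple of all the elements that make the individual identities true in `B` and in
  -- `C`.
  let T : S := t * ∏ i, ∏ j, t' i j
  refine ⟨_, c, T.1 • h, T.1 * s.1, (T * s).2, fun i j => ?_, fun x => ?_⟩
  · have : t' i j ∣ T := (Finset.dvd_prod_of_mem _ (Finset.mem_univ j)).trans
      ((Finset.dvd_prod_of_mem (fun i => ∏ j, t' i j) (Finset.mem_univ i)).trans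
        (Dvd.intro_left _ rfl))
    obtain ⟨u, hu⟩ := this
    have h₁ : T.1 = u.1 * (t' i j).1 := by rw [hu, mul_comm]; rfl
    have h₂ := ht' i j
    simp only [Submonoid.smul_def, smul_eq_mul] at h₂
    simp only [LinearMap.smul_apply, Pi.smul_apply, smul_eq_mul, h₁, mul_assoc, h₂]
    split_ifs <;> simp
  · have h₁ := DFunLike.congr_fun ht x
    have h₂ := congrArg (fun y => (∏ i, ∏ j, t' i j).1 • y) h₁
    simp only [Submonoid.smul_def, LinearMap.smul_apply, LinearMap.id_apply, LinearMap.sum_apply,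
      LinearMap.comp_apply, LinearMap.toSpanSingleton_apply, LinearMap.proj_apply, ← mul_smul,
      Finset.smul_sum] at h₂
    have h₃ : T.1 = (∏ i, ∏ j, t' i j).1 * t.1 := by rw [mul_comm]; rfl
    simp only [h₃, LinearMap.smul_apply, Pi.smul_apply, smul_eq_mul, mul_assoc]
    exact h₂

-- Smoothness of both rings splits the conormal map `I/I² → B ⊗ Ω`, where `I` is the kernel of `A →
-- B`, so `I/I²` is finite projective. The derivations are the universal one followed by the
-- retraction and the local coordinates of `I/I²`.
open TensorProduct in
theorem exists_derivation_family {K A B : Type u} [CommRing K] [CommRing A] [CommRing B]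
    [Algebra K A] [Algebra K B] [Algebra A B] [IsScalarTower K A B] [IsNoetherianRing A]
    [Algebra.FormallySmooth K A] [Algebra.FormallySmooth K B]
    (hs : Function.Surjective (algebraMap A B)) (p : Ideal B) [p.IsPrime] :
    ∃ (r : ℕ) (f : Fin r → A) (δ : Fin r → Derivation K A B) (g : A),
      algebraMap A B g ∉ p ∧ (∀ i, algebraMap A B (f i) = 0) ∧
      (∀ i j, δ i (f j) = if i = j then algebraMap A B g else 0) ∧
      ∀ x, algebraMap A B x = 0 →
        g * x ∈ Ideal.span (Set.range f) ⊔ RingHom.ker (algebraMap A B) ^ 2 := by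
  let P : Algebra.Extension K B := 
    { Ring := A, σ := Function.surjInv hs, algebraMap_σ := Function.surjInv_eq hs }
  have : IsNoetherianRing P.Ring := inferInstanceAs (IsNoetherianRing A)
  have : Algebra.FormallySmooth K P.Ring := inferInstanceAs (Algebra.FormallySmooth K A)
  obtain ⟨l, hl⟩ := P.formallySmooth_iff_split_injection.mp inferInstance
  have : Module.Projective B P.Cotangent := .of_split _ l hl
  have : Module.Finite B P.Cotangent := Algebra.Extension.Cotangent.finite
    (IsNoetherian.noetherian P.ker)
  have : Module.FinitePresentation B P.Cotangent := Module.finitePresentation_of_projective _ _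
  obtain ⟨r, c, h, s, hsp, hc, hx⟩ := exists_dual_family (C := P.Cotangent) p
  choose f hf using fun i => Algebra.Extension.Cotangent.mk_surjective (c i)
  obtain ⟨g, rfl⟩ := hs s
  let δ : Fin r → Derivation K A B := fun i =>
    ((LinearMap.proj i ∘ₗ h ∘ₗ l).restrictScalars A ∘ₗ
      (TensorProduct.mk A B (Ω[A⁄K]) 1)).compDer (KaehlerDifferential.D K A)
  refine ⟨r, fun i => (f i).1, δ, g, hsp, fun i => (f i).2, fun i j => ?_, fun x hx' => ?_⟩
  · rw [← hc i j, ← hf j]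
    have := DFunLike.congr_fun hl (.mk (f j))
    exact congrArg (fun y => h y i) this
  · have := hx (.mk (P := P) ⟨x, hx'⟩)
    choose a ha using fun i => hs (h (.mk (P := P) ⟨x, hx'⟩) i)
    have h₁ : Algebra.Extension.Cotangent.mk (P := P)
        ((g : P.Ring) • ⟨x, hx'⟩ - ∑ i, (a i : P.Ring) • f i) = 0 := by
      rw [map_sub, map_smul, map_sum, sub_eq_zero]
      refine this.trans (Finset.sum_congr rfl fun i _ => ?_)
      rw [map_smul, hf, ← ha]
      rfl
    rw [Algebra.Extension.Cotangent.mk_eq_zero_iff, AddSubgroupClass.coe_sub,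
      AddSubmonoidClass.coe_finsetSum] at h₁
    rw [← sub_add_cancel (g * x) (∑ i, a i * (f i).1), add_comm]
    refine Submodule.add_mem_sup (Ideal.sum_mem _ fun i _ =>
      Ideal.mul_mem_left _ _ (Ideal.subset_span ⟨i, rfl⟩)) h₁

/-- Nakayama's lemma in the form of Cayley–Hamilton: multiplication by `g` maps `I / (I ∩ J)` into
`I` times itself, so a monic polynomial in `g` with lower coefficients in `I` kills it. -/
theorem exists_mul_mem_of_mul_mem_sup_sq {A : Type*} [CommRing A] {I J p : Ideal A} [p.IsPrime]
    (hI : I.FG) (hIp : I ≤ p) {g : A} (hg : g ∉ p) (h : ∀ x ∈ I, g * x ∈ J ⊔ I ^ 2) :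
    ∃ g' ∉ p, ∀ x ∈ I, g' * x ∈ J := by
  let N : Submodule A I := Submodule.comap I.subtype J
  have : Module.Finite A I := Module.Finite.iff_fg.mpr hI
  obtain ⟨q, hq, -, hq', hq₀⟩ :=
    LinearMap.exists_monic_and_natDegree_eq_and_coeff_mem_pow_and_aeval_eq_zero A
      (algebraMap A (Module.End A (I ⧸ N)) g) I <| by
    rintro _ ⟨m, rfl⟩
    obtain ⟨⟨x, hx⟩, rfl⟩ := Submodule.Quotient.mk_surjective _ m
    obtain ⟨j, hj, y, hy, hjy⟩ := Submodule.mem_sup.mp (h x hx)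
    have hyI : y ∈ I := Ideal.pow_le_self two_ne_zero hy
    have hy' : (⟨y, hyI⟩ : I) ∈ I • (⊤ : Submodule A I) := by
      rw [Submodule.mem_smul_top_iff]
      simpa [pow_two] using hy
    have h₁ : algebraMap A (Module.End A (I ⧸ N)) g (Submodule.Quotient.mk ⟨x, hx⟩) =
        N.mkQ ⟨y, hyI⟩ := by
      rw [Module.algebraMap_end_apply, ← Submodule.Quotient.mk_smul]
      refine (Submodule.Quotient.eq _).mpr ?_
      change g * x - y ∈ J
      rwa [← hjy, add_sub_cancel_right]
    rw [h₁]
    have h₂ := Submodule.mem_map_of_mem (f := N.mkQ) hy'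
    rw [Submodule.map_smul''] at h₂
    exact Submodule.smul_mono le_rfl le_top h₂
  refine ⟨q.eval g, fun hqp => ?_, fun x hx => ?_⟩
  -- The value is a power of `g` plus an element of `I ⊆ p`.
  · rw [Polynomial.eval_eq_sum_range, Finset.sum_range_succ, hq.coeff_natDegree, one_mul] at hqp
    refine hg (Ideal.IsPrime.mem_of_pow_mem ‹_› _ ((Submodule.add_mem_iff_right _ ?_).mp hqp))
    refine Ideal.sum_mem _ fun i hi => Ideal.mul_mem_right _ _ (hIp ?_)
    exact Ideal.pow_le_self (by simp at hi; omega) (hq' i)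
  · rw [Polynomial.aeval_algebraMap_apply] at hq₀
    have := DFunLike.congr_fun hq₀ (Submodule.Quotient.mk ⟨x, hx⟩)
    rw [Module.algebraMap_end_apply, Polynomial.coe_aeval_eq_eval] at this
    exact (Submodule.Quotient.mk_eq_zero N).mp this

-- Over `B' = A' ⧸ IA'` the element `g` is invertible, so the derivations can be normalized to be
-- dual to `f`. Denominators are cleared so that the Taylor argument runs over `A`, the ring known
-- to be formally smooth, with values in `B'`.
open MvPolynomial in
theorem QuasiRegular.of_derivation {K A B : Type*} [CommRing K] [CommRing A] [CommRing B]
    [Algebra K A] [Algebra K B] [Algebra A B] [IsScalarTower K A B] [Algebra.FormallySmooth K A]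
    {r : ℕ} (f : Fin r → A) (hf : ∀ i, algebraMap A B (f i) = 0) (δ : Fin r → Derivation K A B)
    {g : A} (hδ : ∀ i j, δ i (f j) = if i = j then algebraMap A B g else 0)
    (hg : ∀ x, algebraMap A B x = 0 → g * x ∈ Ideal.span (Set.range f))
    (hs : Function.Surjective (algebraMap A B))
    (S : Submonoid A) {A' : Type*} [CommRing A'] [Algebra A A'] [IsLocalization S A']
    (hgS : IsUnit (algebraMap A A' g)) :
    QuasiRegular ((RingHom.ker (algebraMap A B)).map (algebraMap A A'))
      (fun i => algebraMap A A' (f i)) where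
  span_eq := by
    have h₁ : Set.range (fun i => algebraMap A A' (f i)) = algebraMap A A' '' Set.range f := by
      rw [← Set.range_comp]; rfl
    rw [h₁, ← Ideal.map_span]
    refine le_antisymm (Ideal.map_mono (Ideal.span_le.mpr ?_)) (Ideal.map_le_iff_le_comap.mpr ?_)
    · rintro _ ⟨i, rfl⟩
      exact hf i
    · intro x hx
      have := Ideal.mem_map_of_mem (algebraMap A A') (hg x hx)
      rw [map_mul] at this
      exact (Ideal.unit_mul_mem_iff_mem _ hgS).mp this
  coeff_mem d F hF h m := by
    let B' := A' ⧸ (RingHom.ker (algebraMap A B)).map (algebraMap A A')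
    let _ : Algebra K B' := ((algebraMap A B').comp (algebraMap K A)).toAlgebra
    have : IsScalarTower K A B' := .of_algebraMap_eq' rfl
    have hB' : ∀ x, algebraMap A B' x = Ideal.Quotient.mk _ (algebraMap A A' x) := fun x => rfl
    have hker : ∀ x, algebraMap A B x = 0 → algebraMap A B' x = 0 := fun x hx => by
      rw [hB', Ideal.Quotient.eq_zero_iff_mem]
      exact Ideal.mem_map_of_mem _ hx
    let ρ : B →ₗ[A] B' := (Submodule.liftQ (LinearMap.ker (Algebra.linearMap A B))
      (Algebra.linearMap A B') hker) ∘ₗ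
        (LinearMap.quotKerEquivOfSurjective (Algebra.linearMap A B) hs).symm.toLinearMap
    have hρ : ∀ x, ρ (algebraMap A B x) = algebraMap A B' x := fun x => by
      have : (LinearMap.quotKerEquivOfSurjective (Algebra.linearMap A B) hs).symm
          (algebraMap A B x) = Submodule.Quotient.mk x := by
        rw [LinearEquiv.symm_apply_eq]
        rfl
      rw [LinearMap.comp_apply, LinearEquiv.coe_coe, this]
      rfl
    have hu : IsUnit (algebraMap A B' g) := by rw [hB']; exact hgS.map _
    let v : B' := ↑hu.unit⁻¹
    have hv : v * algebraMap A B' g = 1 := hu.val_inv_mul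
    let δ' : Fin r → Derivation K A B' := fun i => (LinearMap.mulLeft A v ∘ₗ ρ).compDer (δ i)
    have hδ' : ∀ i j, δ' i (f j) = if i = j then 1 else 0 := fun i j => by
      change v * ρ (δ i (f j)) = _
      rw [hδ]
      split_ifs
      · rw [hρ, hv]
      · rw [map_zero, mul_zero]
    obtain ⟨s, hsF⟩ := IsLocalization.exist_integer_multiples S F.support (fun m => coeff m F)
    choose! a ha using hsF
    let G : MvPolynomial (Fin r) A := ∑ m ∈ F.support, monomial m (a m)
    have hG : G.IsHomogeneous d := IsHomogeneous.sum _ _ _ fun m hm =>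
      isHomogeneous_monomial _
        (not_imp_comm.mp hF.coeff_eq_zero (mem_support_iff.mp hm))
    have hGF : map (algebraMap A A') G = C (algebraMap A A' s) * F := by
      conv_rhs => rw [F.as_sum, Finset.mul_sum]
      simp only [G, map_sum, map_monomial, C_mul_monomial]
      refine Finset.sum_congr rfl fun m hm => ?_
      rw [ha m hm, Algebra.smul_def]
    have h₁ : algebraMap A A' (aeval f G) ∈
        (RingHom.ker (algebraMap A B) ^ (d + 1)).map (algebraMap A A') := by
      have h₂ : algebraMap A A' (aeval f G) =
          algebraMap A A' s * aeval (fun i => algebraMap A A' (f i)) F := by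
        rw [← aeval_algebraMap_apply, ← aeval_map_algebraMap A', hGF, map_mul, aeval_C]
        rfl
      rw [h₂, Ideal.map_pow]
      exact Ideal.mul_mem_left _ _ h
    -- Membership in the extended power of the kernel holds in `A` itself only after another
    -- denominator `t`; it is a unit in `A'`, so it is cancelled at the end.
    obtain ⟨t, ht, htG⟩ := (IsLocalization.algebraMap_mem_map_algebraMap_iff S A' _ _).mp h₁
    have h₂ := coeff_mem_ker_of_derivation f (fun i => hker _ (hf i)) δ' hδ' d (C t * G)
      (hG.C_mul t) (by
        rw [map_mul, aeval_C]
        exact Ideal.pow_right_mono (fun x hx => hker x hx) _ htG) m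
    rw [coeff_C_mul, RingHom.mem_ker, hB', Ideal.Quotient.eq_zero_iff_mem, map_mul,
      Ideal.unit_mul_mem_iff_mem _ (IsLocalization.map_units A' ⟨t, ht⟩), ← coeff_map, hGF,
      coeff_C_mul, Ideal.unit_mul_mem_iff_mem _ (IsLocalization.map_units A' s)] at h₂
    exact h₂

/-! ### The length of a quasi-regular sequence -/

section length

open MvPolynomial

theorem exists_isHomogeneous_of_mem_span_pow {A : Type*} [CommRing A] {r : ℕ} (f : Fin r → A)
    (n : ℕ) {y : A} (hy : y ∈ Ideal.span (Set.range f) ^ n) :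
    ∃ F : MvPolynomial (Fin r) A, F.IsHomogeneous n ∧ aeval f F = y := by
  induction n generalizing y with
  | zero => exact ⟨C y, isHomogeneous_C _ _, by simp⟩
  | succ n ih =>
    rw [pow_succ] at hy
    refine Submodule.mul_induction_on hy (fun a ha b hb => ?_) fun a b ⟨F, hF, hFa⟩ ⟨G, hG, hGb⟩ =>
      ⟨F + G, hF.add hG, by rw [map_add, hFa, hGb]⟩
    obtain ⟨F, hF, rfl⟩ := ih ha
    obtain ⟨c, rfl⟩ := (Ideal.mem_span_range_iff_exists_fun).mp hb
    refine ⟨F * ∑ i, C (c i) * X i, hF.mul (IsHomogeneous.sum _ _ _ fun i _ => ?_), by simp⟩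
    exact (isHomogeneous_X _ i).C_mul (c i)

namespace QuasiRegular

variable {A : Type*} [CommRing A] {I : Ideal A} {r : ℕ}

theorem mem (f : Fin r → A) (h : QuasiRegular I f) (i : Fin r) : f i ∈ I :=
  h.span_eq ▸ Ideal.subset_span ⟨i, rfl⟩

theorem exists_isHomogeneous {f : Fin r → A} (h : QuasiRegular I f) {n : ℕ} {y : A}
    (hy : y ∈ I ^ n) : ∃ F : MvPolynomial (Fin r) A, F.IsHomogeneous n ∧ aeval f F = y :=
  exists_isHomogeneous_of_mem_span_pow f n (h.span_eq ▸ hy)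

theorem aeval_mem {f : Fin r → A} (h : QuasiRegular I f) {n : ℕ} {F : MvPolynomial (Fin r) A}
    (hF : F.IsHomogeneous n) : aeval f F ∈ I ^ n := by
  rw [aeval_eq_eval₂Hom, coe_eval₂Hom, eval₂_eq']
  refine Ideal.sum_mem _ fun m hm => Ideal.mul_mem_left _ _ ?_
  have hdeg := not_imp_comm.mp hF.coeff_eq_zero (mem_support_iff.mp hm)
  rw [← hdeg, Finsupp.degree_eq_sum, ← Finset.prod_pow_eq_pow_sum]
  exact Ideal.prod_mem_prod fun i _ => Ideal.pow_mem_pow (h.mem f i) _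

theorem aeval_mem_succ {f : Fin r → A} (h : QuasiRegular I f) {n : ℕ} {F : MvPolynomial (Fin r) A}
    (hF : F.IsHomogeneous n) (hc : ∀ m, coeff m F ∈ I) : aeval f F ∈ I ^ (n + 1) := by
  rw [aeval_eq_eval₂Hom, coe_eval₂Hom, eval₂_eq', pow_succ']
  refine Ideal.sum_mem _ fun m hm => Ideal.mul_mem_mul (hc m) ?_
  have hdeg := not_imp_comm.mp hF.coeff_eq_zero (mem_support_iff.mp hm)
  rw [← hdeg, Finsupp.degree_eq_sum, ← Finset.prod_pow_eq_pow_sum]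
  exact Ideal.prod_mem_prod fun i _ => Ideal.pow_mem_pow (h.mem f i) _

/-- `f 0` acts as a variable, hence a nonzerodivisor, on the associated graded ring. With Krull's
intersection theorem this makes it a nonzerodivisor in the local case. -/
theorem mem_pow_of_mul_mem {f : Fin (r + 1) → A} (h : QuasiRegular I f) (n : ℕ) {b : A}
    (hb : f 0 * b ∈ I ^ (n + 1)) : b ∈ I ^ n := by
  induction n with
  | zero => simp
  | succ n ih =>
    obtain ⟨F, hF, rfl⟩ := h.exists_isHomogeneous (ih (Ideal.pow_le_pow_right (by omega) hb))
    refine h.aeval_mem_succ hF fun m => ?_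
    rw [← coeff_X_mul m 0]
    refine h.coeff_mem (1 + n) _ ((isHomogeneous_X _ _).mul hF) ?_ _
    rw [map_mul, aeval_X, add_comm 1]
    exact hb

theorem mem_nonZeroDivisors [IsLocalRing A] [IsNoetherianRing A] {f : Fin (r + 1) → A}
    (h : QuasiRegular I f) (hI : I ≠ ⊤) : f 0 ∈ nonZeroDivisors A := by
  rw [mem_nonZeroDivisors_iff_right]
  intro b hb
  have : b ∈ ⨅ n : ℕ, I ^ n := by
    rw [Ideal.mem_iInf]
    intro n
    refine h.mem_pow_of_mul_mem n ?_
    rw [mul_comm, hb]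
    exact zero_mem _
  rwa [Ideal.iInf_pow_eq_bot_of_isLocalRing I hI] at this

/-- If a form `G` in the later variables has value in `I^(d+1)` modulo `f 0`, it is corrected by
some `X 0 * H` to a form whose value is in `I^(d+1)`. The correction does not touch the monomials
free of `X 0`. -/
theorem quotient {f : Fin (r + 1) → A} (h : QuasiRegular I f) :
    QuasiRegular (I.map (Ideal.Quotient.mk (Ideal.span {f 0})))
      (fun i : Fin r => Ideal.Quotient.mk (Ideal.span {f 0}) (f i.succ)) where
  span_eq := by
    refine le_antisymm (Ideal.span_le.mpr ?_) (Ideal.map_le_iff_le_comap.mpr ?_)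
    · rintro _ ⟨i, rfl⟩
      exact Ideal.mem_map_of_mem _ (h.mem f _)
    · rw [← h.span_eq, Ideal.span_le]
      rintro _ ⟨i, rfl⟩
      refine Fin.cases ?_ (fun i => ?_) i
      · simp [Ideal.Quotient.eq_zero_iff_mem.mpr (Ideal.mem_span_singleton_self (f 0))]
      · exact Ideal.subset_span ⟨i, rfl⟩
  coeff_mem d F hF hd m := by
    obtain ⟨G, hG, rfl⟩ : ∃ G : MvPolynomial (Fin r) A, G.IsHomogeneous d ∧
        map (Ideal.Quotient.mk (Ideal.span {f 0})) G = F := by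
      obtain ⟨G, rfl⟩ := map_surjective _ Ideal.Quotient.mk_surjective F
      refine ⟨homogeneousComponent d G, homogeneousComponent_isHomogeneous _ _, ?_⟩
      ext m
      rw [coeff_map, coeff_homogeneousComponent]
      split_ifs with hm
      · rw [coeff_map]
      · rw [hF.coeff_eq_zero hm, map_zero]
    let G' := rename Fin.succ G
    have hG' : G'.IsHomogeneous d := hG.rename_isHomogeneous
    obtain ⟨H, hH, hH'⟩ : ∃ H, (X 0 * H).IsHomogeneous d ∧
        aeval f G' - f 0 * aeval f H ∈ I ^ (d + 1) := by
      have h₁ : aeval (fun i : Fin r => Ideal.Quotient.mk (Ideal.span {f 0}) (f i.succ))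
          (map (Ideal.Quotient.mk (Ideal.span {f 0})) G) =
          Ideal.Quotient.mk (Ideal.span {f 0}) (aeval f G') := by
        rw [show aeval f G' = aeval (f ∘ Fin.succ) G from aeval_rename _ _ _]
        simp only [aeval_def, eval₂_map, hom_eval₂]
        rfl
      rw [h₁, ← Ideal.map_pow, Ideal.mem_map_iff_of_surjective _ Ideal.Quotient.mk_surjective] at hd
      obtain ⟨y, hy, hyG⟩ := hd
      rw [eq_comm, Ideal.Quotient.eq, Ideal.mem_span_singleton'] at hyG
      obtain ⟨b, hb⟩ := hyG
      have h₂ : f 0 * b ∈ I ^ d := by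
        rw [mul_comm, hb]
        exact sub_mem (h.aeval_mem hG') (Ideal.pow_le_pow_right (by omega) hy)
      -- In degree `0` there is no room for a correction term, and none is needed since `f 0 ∈ I`.
      cases d with
      | zero =>
        refine ⟨0, by simpa using isHomogeneous_zero (Fin (r + 1)) A 0, ?_⟩
        rw [map_zero, mul_zero, sub_zero, ← sub_add_cancel (aeval f G') y, ← hb]
        refine add_mem (Ideal.mul_mem_left _ _ ?_) hy
        simpa using h.mem f 0
      | succ d =>
        obtain ⟨H, hH, rfl⟩ := h.exists_isHomogeneous (h.mem_pow_of_mul_mem d h₂)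
        refine ⟨H, by simpa [add_comm] using (isHomogeneous_X A (0 : Fin (r + 1))).mul hH, ?_⟩
        rw [mul_comm, hb, sub_sub_cancel]
        exact hy
    have h₃ := h.coeff_mem d (G' - X 0 * H) (hG'.sub hH) (by simpa using hH') (m.mapDomain Fin.succ)
    rw [coeff_sub, coeff_rename_mapDomain _ (Fin.succ_injective _), coeff_X_mul'] at h₃
    rw [if_neg, sub_zero] at h₃
    · rw [coeff_map]
      exact Ideal.mem_map_of_mem _ h₃
    · classical
      intro h₀
      obtain ⟨i, -, hi⟩ := Finset.mem_image.mp (Finsupp.mapDomain_support h₀)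
      exact Fin.succ_ne_zero i hi

/-- Dividing by the nonzerodivisor `f 0` lowers the dimension by exactly one and leaves a
quasi-regular sequence with one term less. -/
theorem le_ringKrullDim {A : Type*} [CommRing A] [IsLocalRing A] [IsNoetherianRing A] {I : Ideal A}
    {r : ℕ} {f : Fin r → A} (h : QuasiRegular I f) (hI : I ≤ IsLocalRing.maximalIdeal A) :
    (r : WithBot ℕ∞) ≤ ringKrullDim A := by
  induction r generalizing A with
  | zero => simpa using ringKrullDim_nonneg_of_nontrivial
  | succ r ih =>
    have hf : f 0 ∈ IsLocalRing.maximalIdeal A := hI (h.mem f 0)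
    have h₁ := ringKrullDim_quotient_span_singleton_succ_eq_ringKrullDim_of_mem_nonZeroDivisors
      (h.mem_nonZeroDivisors (fun h => by
        rw [h, top_le_iff] at hI
        exact Ideal.IsPrime.ne_top' hI)) hf
    have hne : Ideal.span {f 0} ≠ ⊤ := fun h' =>
      (IsLocalRing.maximalIdeal.isMaximal A).ne_top (top_le_iff.mp
        (h' ▸ (Ideal.span_singleton_le_iff_mem _).mpr hf))
    have : Nontrivial (A ⧸ Ideal.span {f 0}) := Ideal.Quotient.nontrivial_iff.mpr hne
    have := IsLocalRing.of_surjective' (Ideal.Quotient.mk (Ideal.span {f 0}))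
      Ideal.Quotient.mk_surjective
    rw [← h₁, Nat.cast_succ]
    gcongr
    refine ih h.quotient ?_
    have hmax := Ideal.comap_isMaximal_of_surjective (Ideal.Quotient.mk (Ideal.span {f 0}))
      Ideal.Quotient.mk_surjective (K := IsLocalRing.maximalIdeal (A ⧸ Ideal.span {f 0}))
    exact Ideal.map_le_iff_le_comap.mpr (hI.trans (IsLocalRing.eq_maximalIdeal hmax).ge)

end QuasiRegular

end length

/-! ### Smooth centers are locally cut out by quasi-regular sequences -/

/-- All localizations inverting `g` are allowed because two are used: a basic open neighbourhood,
for local equations, and the local ring at a minimal prime, for its height. -/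
theorem exists_quasiRegular_localization {K A B : Type u} [CommRing K] [CommRing A] [CommRing B]
    [Algebra K A] [Algebra K B] [Algebra A B] [IsScalarTower K A B] [IsNoetherianRing A]
    [Algebra.FormallySmooth K A] [Algebra.FormallySmooth K B]
    (hs : Function.Surjective (algebraMap A B)) (p : Ideal B) [p.IsPrime] :
    ∃ (r : ℕ) (f : Fin r → A) (g : A), algebraMap A B g ∉ p ∧
      (∀ (S : Submonoid A) (A' : Type u) [CommRing A'] [Algebra A A'] [IsLocalization S A'],
        IsUnit (algebraMap A A' g) → QuasiRegular
          ((RingHom.ker (algebraMap A B)).map (algebraMap A A')) (fun i => algebraMap A A' (f i))) ∧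
      ∀ q ∈ (RingHom.ker (algebraMap A B)).minimalPrimes, g ∉ q → q.height = r := by
  obtain ⟨r, f, δ, g, hg, hf, hδ, hI⟩ := exists_derivation_family (K := K) hs p
  have hp : RingHom.ker (algebraMap A B) ≤ p.comap (algebraMap A B) := fun x hx => by
    rw [Ideal.mem_comap, RingHom.mem_ker.mp hx]
    exact zero_mem _
  obtain ⟨g', hg', hI'⟩ := exists_mul_mem_of_mul_mem_sup_sq
    (IsNoetherian.noetherian (RingHom.ker (algebraMap A B))) hp hg hI
  have hloc : ∀ (S : Submonoid A) (A' : Type u) [CommRing A'] [Algebra A A'] [IsLocalization S A'],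
      IsUnit (algebraMap A A' (g * g')) → QuasiRegular
        ((RingHom.ker (algebraMap A B)).map (algebraMap A A'))
        (fun i => algebraMap A A' (f i)) := by
    intro S A' _ _ _ hu
    refine QuasiRegular.of_derivation (K := K) f hf (fun i => algebraMap A B g' • δ i) ?_ ?_ hs S hu
    · intro i j
      rw [Derivation.smul_apply, hδ, map_mul, mul_comm, smul_eq_mul]
      split_ifs <;> simp
    · intro x hx
      rw [mul_assoc]
      exact Ideal.mul_mem_left _ _ (hI' x hx)
  refine ⟨r, f, g * g', ?_, hloc, fun q hq hgq => ?_⟩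
  · exact fun h => ((inferInstance : (p.comap (algebraMap A B)).IsPrime).mem_or_mem h).elim hg hg'
  · have := hq.1.1
    have hfI : Ideal.span (Set.range f) ≤ RingHom.ker (algebraMap A B) := by
      rw [Ideal.span_le]
      rintro _ ⟨i, rfl⟩
      exact hf i
    have hg'q : g' ∉ q := fun h => hgq (Ideal.mul_mem_left _ _ h)
    refine le_antisymm ?_ ?_
    -- Away from `g'` the ideal of the center agrees with that generated by `f`, so `q` is also
    -- minimal over the latter and Krull's height theorem applies.
    · have hq' : q ∈ (Ideal.span (Set.range f)).minimalPrimes := by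
        refine ⟨⟨this, hfI.trans hq.1.2⟩, fun q' ⟨hq'₁, hq'₂⟩ hle => hq.2 ⟨hq'₁, fun x hx => ?_⟩ hle⟩
        exact (hq'₁.mem_or_mem (hq'₂ (hI' x hx))).resolve_left fun h => hg'q (hle h)
      classical
      have hs' : (Finset.univ.image f : Set A) = Set.range f := by simp
      rw [← hs'] at hq'
      refine (Ideal.height_le_card_of_mem_minimalPrimes_span_finset hq').trans ?_
      exact_mod_cast Finset.card_image_le.trans (by simp)
    · have h := (hloc q.primeCompl (Localization.AtPrime q)
        (IsLocalization.map_units (M := q.primeCompl) _ ⟨g * g', hgq⟩)).le_ringKrullDim ?_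
      · rw [IsLocalization.AtPrime.ringKrullDim_eq_height q] at h
        exact_mod_cast h
      · rw [← IsLocalization.AtPrime.map_eq_maximalIdeal q (Localization.AtPrime q)]
        exact Ideal.map_mono hq.1.2

namespace AlgebraicGeometry

theorem IsAffineOpen.fromSpec_mem_basicOpen_iff {V : Scheme.{u}} {U : V.Opens}
    (hU : IsAffineOpen U) (f : Γ(V, U)) (x : Spec Γ(V, U)) :
    hU.fromSpec x ∈ V.basicOpen f ↔ f ∉ x.asIdeal := by
  change x ∈ hU.fromSpec ⁻¹ᵁ V.basicOpen f ↔ _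
  rw [hU.fromSpec_preimage_basicOpen]
  rfl

namespace Scheme.IdealSheafData

variable {k : Type u} [Field k] {V : Scheme.{u}} (I : V.IdealSheafData)

theorem fromSpec_mem_support_iff (U : V.affineOpens) (x : Spec Γ(V, U.1)) :
    U.2.fromSpec x ∈ I.support ↔ I.ideal U ≤ x.asIdeal := by
  have hx : U.2.fromSpec x ∈ U.1 := by
    rw [← SetLike.mem_coe, ← U.2.range_fromSpec]
    exact ⟨x, rfl⟩
  rw [I.mem_support_iff_of_mem hx, Scheme.mem_zeroLocus_iff]
  simp only [U.2.fromSpec_mem_basicOpen_iff, not_not]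
  rfl

/-- Around each point of a smooth center there is an affine open on which the center is cut out by
a quasi-regular sequence, whose length is the codimension of the center. -/
theorem exists_quasiRegular (t : V ⟶ Spec (CommRingCat.of k)) [Smooth t]
    [Smooth (I.subschemeι ≫ t)] [IrreducibleSpace I.subscheme] (c : I.subscheme) :
    ∃ (U : V.affineOpens) (r : ℕ) (f : Fin r → Γ(V, U.1)), I.subschemeι c ∈ U.1 ∧
      QuasiRegular (I.ideal U) f ∧ r = Order.coheight (I.subschemeι (genericPoint I.subscheme)) := by
  have : IsLocallyNoetherian V := LocallyOfFiniteType.isLocallyNoetherian t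
  obtain ⟨U, hU, hcU, -⟩ := exists_isAffineOpen_mem_and_subset
    (show I.subschemeι c ∈ (⊤ : V.Opens) from trivial)
  have hU' : IsAffineOpen (I.subschemeι ⁻¹ᵁ U) := hU.preimage _
  let K := Γ(Spec (CommRingCat.of k), ⊤)
  let φ := t.appLE ⊤ U le_top
  let ψ := (I.subschemeι ≫ t).appLE ⊤ (I.subschemeι ⁻¹ᵁ U) le_top
  let _ : Algebra K Γ(V, U) := φ.hom.toAlgebra
  let _ : Algebra K Γ(I.subscheme, I.subschemeι ⁻¹ᵁ U) := ψ.hom.toAlgebra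
  let _ : Algebra Γ(V, U) Γ(I.subscheme, I.subschemeι ⁻¹ᵁ U) := (I.subschemeι.app U).hom.toAlgebra
  have : IsScalarTower K Γ(V, U) Γ(I.subscheme, I.subschemeι ⁻¹ᵁ U) :=
    .of_algebraMap_eq' (by
      change ψ.hom = (φ ≫ I.subschemeι.app U).hom
      congr 1
      rw [Scheme.Hom.app_eq_appLE]
      exact (Scheme.Hom.appLE_comp_appLE _ _ _ _ _ le_top le_rfl).symm)
  have : IsNoetherianRing Γ(V, U) := IsLocallyNoetherian.component_noetherian ⟨U, hU⟩
  have : Algebra.FormallySmooth K Γ(V, U) :=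
    (t.smooth_appLE (isAffineOpen_top _) hU le_top).formallySmooth
  have : Algebra.FormallySmooth K Γ(I.subscheme, I.subschemeι ⁻¹ᵁ U) :=
    ((I.subschemeι ≫ t).smooth_appLE (isAffineOpen_top _) hU' le_top).formallySmooth
  have hs : Function.Surjective (algebraMap Γ(V, U) Γ(I.subscheme, I.subschemeι ⁻¹ᵁ U)) :=
    I.subschemeι_app_surjective ⟨U, hU⟩
  have hker : RingHom.ker (algebraMap Γ(V, U) Γ(I.subscheme, I.subschemeι ⁻¹ᵁ U)) =
    I.ideal ⟨U, hU⟩ := I.ker_subschemeι_app ⟨U, hU⟩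
  obtain ⟨p, hp⟩ : c ∈ Set.range hU'.fromSpec := by rw [hU'.range_fromSpec]; exact hcU
  have := p.2
  obtain ⟨r, f, g, hgp, hloc, hq⟩ := exists_quasiRegular_localization (K := K) hs p.asIdeal
  have hcg : I.subschemeι c ∈ V.basicOpen g := by
    change c ∈ I.subschemeι ⁻¹ᵁ V.basicOpen g
    rw [Scheme.preimage_basicOpen, ← hp]
    exact (hU'.fromSpec_mem_basicOpen_iff _ p).mpr hgp
  have := hU.isLocalization_basicOpen g
  have h₁ := hloc (Submonoid.powers g) Γ(V, V.basicOpen g)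
    (IsLocalization.Away.algebraMap_isUnit g)
  refine ⟨V.affineBasicOpen (U := ⟨U, hU⟩) g, r,
    fun i => algebraMap Γ(V, U) Γ(V, V.basicOpen g) (f i), hcg, ?_, ?_⟩
  · rw [← I.map_ideal_basicOpen, ← hker]
    exact h₁
  -- The generic point of the center lies in every open that meets it, so the length can be computed
  -- there and is the same for all `c`.
  · let η := genericPoint I.subscheme
    have hη : I.subschemeι η ∈ V.basicOpen g :=
      (genericPoint_specializes c).mem_open (I.subschemeι ⁻¹ᵁ V.basicOpen g).isOpen hcg
    obtain ⟨q, hqη⟩ : I.subschemeι η ∈ Set.range hU.fromSpec := by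
      rw [hU.range_fromSpec]
      exact V.basicOpen_le g hη
    change _ = Order.coheight (I.subschemeι η)
    rw [← hqη, coheight_eq_of_isOpenImmersion, ← idealHeight_eq_coheight]
    refine (hq q.asIdeal ⟨⟨q.2, ?_⟩, fun q' ⟨h₂, h₃⟩ h₄ => ?_⟩ ?_).symm
    · rw [hker, ← I.fromSpec_mem_support_iff ⟨U, hU⟩ q]
      change hU.fromSpec q ∈ (I.support : Set V)
      rw [hqη, ← I.range_subschemeι]
      exact ⟨η, rfl⟩
    -- A prime `q'` inside `q` that contains the ideal is a point of the center, hence a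
    -- specialization of the generic point; this gives `q ≤ q'`.
    · rw [hker, ← I.fromSpec_mem_support_iff ⟨U, hU⟩ ⟨q', h₂⟩] at h₃
      change _ ∈ (I.support : Set V) at h₃
      rw [← I.range_subschemeι] at h₃
      obtain ⟨c', hc'⟩ := h₃
      have h₅ := (genericPoint_specializes c').map I.subschemeι.continuous
      change I.subschemeι η ⤳ _ at h₅
      rw [hc', ← hqη] at h₅
      exact (PrimeSpectrum.le_iff_specializes q ⟨q', h₂⟩).mpr
        (hU.fromSpec.isOpenEmbedding.isInducing.specializes_iff.mp h₅)
    · rw [← hqη] at hη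
      exact (hU.fromSpec_mem_basicOpen_iff g q).mp hη

end Scheme.IdealSheafData

end AlgebraicGeometry

/-! ### The class of a blow-up -/

namespace HasFiberClass

variable {k : Type u} [Field k] {W V : Scheme.{u}} {π : W ⟶ V} {κ : K0Var k}

theorem of_isPullback_of_isPullback {W₁ W₂ S : Scheme.{u}} {a₁ : W₁ ⟶ W} {π₁ : W₁ ⟶ S} {b : S ⟶ V}
    {a₂ : W₂ ⟶ W} {π₂ : W₂ ⟶ S} (h₁ : HasFiberClass π₁ κ) (hp₁ : IsPullback a₁ π₁ π b)
    (hp₂ : IsPullback a₂ π₂ π b) : HasFiberClass π₂ κ := by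
  have h := h₁.iso_comp (hp₂.isoIsPullback _ _ hp₁).hom
  rwa [IsPullback.isoIsPullback_hom_snd] at h

end HasFiberClass

namespace AlgebraicGeometry.Scheme.IdealSheafData

variable {V : Scheme.{u}} (I : V.IdealSheafData)

/-- The generic point specializes to every point of the center, and the local dimension can only
grow under specialization. -/
theorem codimension_eq_coheight [IrreducibleSpace I.subscheme] :
    codimension I = Order.coheight (I.subschemeι (genericPoint I.subscheme)) := by
  refine le_antisymm ?_ (le_iInf fun x => ?_)
  · exact iInf_le (fun x : (I.support : Set V) => Order.coheight (x : V))
      ⟨_, I.range_subschemeι.subset ⟨_, rfl⟩⟩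
  · obtain ⟨c, hc⟩ := I.range_subschemeι.superset x.2
    rw [← hc]
    exact Order.coheight_anti ((genericPoint_specializes c).map I.subschemeι.continuous)

theorem ideal_eq_top_of_disjoint (U : V.affineOpens)
    (h : Disjoint (U.1 : Set V) (I.support : Set V)) : I.ideal U = ⊤ := by
  by_contra hI
  obtain ⟨m, hm, hle⟩ := Ideal.exists_le_maximal _ hI
  let x : Spec Γ(V, U.1) := ⟨m, hm.isPrime⟩
  have hx : U.2.fromSpec x ∈ (U.1 : Set V) := by
    rw [← U.2.range_fromSpec]
    exact ⟨x, rfl⟩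
  exact Set.disjoint_left.mp h hx ((I.fromSpec_mem_support_iff U x).mpr hle)

end AlgebraicGeometry.Scheme.IdealSheafData

namespace IsBlowUp

variable {k : Type u} [Field k] {W V : Scheme.{u}} {π : W ⟶ V} {I : V.IdealSheafData}

theorem exists_isPullback (h : IsBlowUp π I) (U : V.affineOpens) :
    ∃ a, IsPullback a (projToSpec (reesGrading (I.ideal U))) π U.2.fromSpec := by
  obtain ⟨e, he⟩ := h U
  refine ⟨e.inv ≫ (π ⁻¹ᵁ U.1).ι, ?_⟩
  have h₁ : IsPullback e.inv (projToSpec (reesGrading (I.ideal U))) (π ∣_ U.1) U.2.isoSpec.inv := by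
    refine .of_horiz_isIso ⟨?_⟩
    rw [← cancel_mono U.1.ι, Category.assoc, Category.assoc, morphismRestrict_ι, ← he,
      Iso.inv_hom_id_assoc]
    rfl
  exact h₁.paste_horiz (isPullback_morphismRestrict π U.1).flip

theorem hasFiberClass_compl (h : IsBlowUp π I) [LocallyOfFiniteType π] [QuasiCompact π]
    {O : Scheme.{u}} (j : O ⟶ V) [IsOpenImmersion j]
    (hj : Set.range j = (Set.range I.subschemeι)ᶜ) :
    HasFiberClass (pullback.snd π j) (1 : K0Var k) := by
  refine HasFiberClass.of_local fun x => ?_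
  obtain ⟨U, hU, hxU, hUj⟩ := exists_isAffineOpen_mem_and_subset
    (show j x ∈ j.opensRange from ⟨x, rfl⟩)
  obtain ⟨a, ha⟩ := h.exists_isPullback ⟨U, hU⟩
  have hle : Set.range hU.fromSpec ⊆ Set.range j := by
    rw [hU.range_fromSpec]
    exact hUj
  refine ⟨_, IsOpenImmersion.lift j hU.fromSpec hle, ?_, ?_, ?_⟩
  · have : IsOpenImmersion (IsOpenImmersion.lift j hU.fromSpec hle ≫ j) := by
      rw [IsOpenImmersion.lift_fac]
      infer_instance
    exact IsOpenImmersion.of_comp _ j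
  · obtain ⟨y, hy⟩ : j x ∈ Set.range hU.fromSpec := by
      rw [hU.range_fromSpec]
      exact hxU
    refine ⟨y, j.isOpenEmbedding.injective ?_⟩
    rw [← hy, ← Scheme.Hom.comp_apply, IsOpenImmersion.lift_fac]
  · refine (HasFiberClass.rees_top (I.ideal_eq_top_of_disjoint ⟨U, hU⟩ ?_)).of_isPullback_of_isPullback
      ha (a₂ := pullback.fst _ _ ≫ pullback.fst π j) ?_
    · rw [← Set.subset_compl_iff_disjoint_right, ← I.range_subschemeι, ← hj]
      exact hUj
    · have := (IsPullback.of_hasPullback (pullback.snd π j)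
        (IsOpenImmersion.lift j hU.fromSpec hle)).paste_horiz (IsPullback.of_hasPullback π j)
      rwa [IsOpenImmersion.lift_fac] at this

theorem hasFiberClass_center (h : IsBlowUp π I) [LocallyOfFiniteType π] [QuasiCompact π] (n : ℕ)
    (hn : ∀ c : I.subscheme, ∃ (U : V.affineOpens) (f : Fin n → Γ(V, U.1)), I.subschemeι c ∈ U.1 ∧
      QuasiRegular (I.ideal U) f) :
    HasFiberClass (pullback.snd π I.subschemeι) (∑ i : Fin n, K0Var.lefschetz k ^ (i : ℕ)) := by
  refine HasFiberClass.of_local fun c => ?_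
  obtain ⟨U, f, hcU, hf⟩ := hn c
  obtain ⟨a, ha⟩ := h.exists_isPullback U
  have := I.subschemeCover.map_prop U
  refine ⟨_, I.subschemeCover.f U, this, ?_, ?_⟩
  · change c ∈ (I.subschemeCover.f U).opensRange
    rw [I.opensRange_subschemeCover_map]
    exact hcU
  · have h₁ := HasFiberClass.rees (k := k) (I := I.ideal U) (fun i => ⟨f i, hf.mem _ i⟩)
      hf.span_eq.ge (fun d F hF hF₀ => by
        ext m
        rw [MvPolynomial.coeff_map, MvPolynomial.coeff_zero, Ideal.Quotient.eq_zero_iff_mem]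
        refine hf.coeff_mem d F hF ?_ m
        rw [hF₀]
        exact zero_mem _)
    have h₂ := (IsPullback.of_hasPullback (projToSpec (reesGrading (I.ideal U)))
      (Spec.map (CommRingCat.ofHom
        (algebraMap Γ(V, U.1) (Γ(V, U.1) ⧸ I.ideal U))))).paste_horiz ha
    have h₃ := (IsPullback.of_hasPullback (pullback.snd π I.subschemeι)
      (I.subschemeCover.f U)).paste_horiz (IsPullback.of_hasPullback π I.subschemeι)
    rw [I.subschemeCover_map_subschemeι, I.glueDataObjι_ι] at h₃
    exact h₁.of_isPullback_of_isPullback h₂ h₃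

/-- The Rees algebra of the zero ideal is concentrated in degree zero, so every prime contains its
irrelevant ideal. -/
theorem isEmpty_of_ideal_eq_bot (h : IsBlowUp π I) (U : V.affineOpens) (hU : I.ideal U = ⊥) :
    IsEmpty ((π ⁻¹ᵁ U.1).toScheme) := by
  obtain ⟨e, -⟩ := h U
  refine ⟨fun w => ?_⟩
  refine (e.hom w).not_irrelevant_le fun x hx => ?_
  have hx' : x = 0 := by
    have h₀ : x ∈ reesGrading (I.ideal U) 0 := by
      refine ⟨(x : Polynomial Γ(V, U.1)).coeff 0, ?_⟩
      change _ = (x : Polynomial Γ(V, U.1))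
      ext n
      rw [Polynomial.coeff_monomial]
      split_ifs with hn
      · rw [hn]
      · have h₁ : I.ideal U ^ n = ⊥ := by rw [hU, Ideal.bot_pow (Ne.symm hn)]
        exact (h₁.le (x.2 n)).symm
    have h₁ := (HomogeneousIdeal.mem_irrelevant_iff (reesGrading (I.ideal U)) x).mp hx
    rwa [GradedRing.proj_apply, DirectSum.decompose_of_mem_same _ h₀] at h₁
  rw [hx']
  exact zero_mem _

end IsBlowUp

/-! ### The blow-up formula -/

namespace SmoothBlowUp

open K0Var

variable {k : Type u} [Field k] {W V : SchemeOver k} {π : W ⟶ V} (S : SmoothBlowUp π)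

include S in
-- In codimension zero the center would be all of `V`, with local equations of length zero, that is,
-- zero ideals. The blow-up would then be empty, whereas `W` is irreducible and so has a generic
-- point.
theorem codim_ne_zero (hW : IsSmoothProperVariety W) (hV : IsSmoothProperVariety V) :
    S.codim ≠ 0 := by
  intro h₀
  have := S.irreducible_center
  have := S.smooth_center
  have := hV.smooth
  have := hV.irreducible
  have := hW.irreducible
  have h₁ : Order.coheight (S.ideal.subschemeι (genericPoint S.ideal.subscheme)) = 0 := by
    rw [← S.ideal.codimension_eq_coheight, ← S.codim_eq, h₀, Nat.cast_zero]
  have h₂ := Order.coheight_eq_zero.mp h₁ (genericPoint_specializes _)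
  have h₃ : ∀ x, x ∈ Set.range S.ideal.subschemeι := fun x => by
    have h₄ : genericPoint V.left ∈ (S.ideal.support : Set V.left) := by
      refine Specializes.mem_closed h₂ S.ideal.support.isClosed ?_
      exact S.ideal.range_subschemeι.subset ⟨_, rfl⟩
    rw [S.ideal.range_subschemeι]
    exact (genericPoint_specializes x).mem_closed S.ideal.support.isClosed h₄
  let w := genericPoint W.left
  obtain ⟨c, hc⟩ := h₃ (π.left w)
  obtain ⟨U, r, f, hcU, hf, hr⟩ := S.ideal.exists_quasiRegular V.hom c
  rw [h₁, Nat.cast_eq_zero] at hr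
  subst hr
  have hU : S.ideal.ideal U = ⊥ := by rw [← hf.span_eq, Set.range_eq_empty, Ideal.span_empty]
  rw [hc] at hcU
  exact (S.isBlowUp.isEmpty_of_ideal_eq_bot U hU).elim ⟨w, hcU⟩

theorem classOf_eq (hW : IsSmoothProperVariety W) (hV : IsSmoothProperVariety V) :
    classOf W.hom = classOf V.hom + lefschetz k *
      (classOf (S.ideal.subschemeι ≫ V.hom) * projClass k ((S.codim : ℤ) - 2)) := by
  have := S.irreducible_center
  have := S.smooth_center
  have := hV.smooth
  have := hV.proper
  have := hW.proper
  have hπ : π.left ≫ V.hom = W.hom := Over.w π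
  have : LocallyOfFiniteType (π.left ≫ V.hom) := hπ ▸ inferInstance
  have : QuasiCompact (π.left ≫ V.hom) := hπ ▸ inferInstance
  have : LocallyOfFiniteType π.left := locallyOfFiniteType_of_comp π.left V.hom
  have : QuasiCompact π.left := QuasiCompact.of_comp π.left V.hom
  obtain ⟨O, j, _, hj⟩ := exists_openImmersion_range_compl S.ideal.subschemeι
  have := quasiCompact_immersion_comp V.hom j
  obtain ⟨m, hm⟩ := Nat.exists_eq_succ_of_ne_zero (S.codim_ne_zero hW hV)
  have hC := (S.isBlowUp.hasFiberClass_center (k := k) S.codim fun c => by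
    obtain ⟨U, r, f, hcU, hf, hr⟩ := S.ideal.exists_quasiRegular V.hom c
    rw [← S.ideal.codimension_eq_coheight, ← S.codim_eq, Nat.cast_inj] at hr
    subst hr
    exact ⟨U, f, hcU, hf⟩).classOf_comp (S.ideal.subschemeι ≫ V.hom)
  have hO := (S.isBlowUp.hasFiberClass_compl (k := k) j hj).classOf_comp (j ≫ V.hom)
  rw [← hπ, classOf_add_pullback (π.left ≫ V.hom) π.left S.ideal.subschemeι j hj,
    classOf_add V.hom S.ideal.subschemeι j hj, pullback.condition_assoc, pullback.condition_assoc, hC,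
    hO, projClass_eq, hm]
  -- With `m + 1` the codimension, `ℙ^m` has `m + 1` cells and `ℙ^{m-1}` has `m`. Positive
  -- codimension provides the cell of class `1`, which completes `V ∖ C` to `V`; for `m = 0` the
  -- other factor is the empty `ℙ^{-1}`.
  have h₁ : ((m.succ : ℤ) - 2 + 1).toNat = m := by push_cast; omega
  rw [h₁, Fin.sum_univ_succ, Fin.val_zero, pow_zero]
  simp only [Fin.val_succ, pow_succ', ← Finset.mul_sum]
  ring

end SmoothBlowUp

/-! ### Weak factorizations -/

theorem sum_succ_sub_castSucc {M : Type*} [AddCommGroup M] {n : ℕ} (x : Fin (n + 1) → M) :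
    ∑ i : Fin n, (x i.succ - x i.castSucc) = x (Fin.last n) - x 0 := by
  rw [Finset.sum_sub_distrib, sub_eq_sub_iff_add_eq_add, add_comm, ← Fin.sum_univ_succ,
    Fin.sum_univ_castSucc, add_comm]

namespace BlowUpSequence

open K0Var

variable {k : Type u} [Field k] {U : Scheme.{u}} {Z X : SchemeOver k} {u : U ⟶ Z.left} {b : Z ⟶ X}

theorem classOf_eq (S : BlowUpSequence u b) :
    classOf Z.hom = classOf X.hom + lefschetz k *
      ∑ j : Fin S.length, S.centerClass j * projClass k ((S.codim j : ℤ) - 2) := by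
  have hstage : ∀ j : Fin S.length, classOf (S.stage j.succ).hom =
      classOf (S.stage j.castSucc).hom +
        lefschetz k * (S.centerClass j * projClass k ((S.codim j : ℤ) - 2)) := fun j => by
    rw [(S.blowUp j).classOf_eq (S.stage_variety _) (S.stage_variety _), centerClass,
      cls_eq_classOf]
    rfl
  have := S.isIso_proj_last
  have h := sum_succ_sub_castSucc fun j => classOf (S.stage j).hom
  simp only [hstage, add_sub_cancel_left] at h
  rw [classOf_eq_of_overIso (asIso (S.proj (Fin.last S.length))),
    ← classOf_eq_of_overIso S.bottom, Finset.mul_sum, h, add_sub_cancel]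

end BlowUpSequence

theorem mainTheorem6 {k : Type u} [Field k] [IsAlgClosed k] [CharZero k] (X Y : SchemeOver k)
    (hX : IsSmoothProperVariety X) (hY : IsSmoothProperVariety Y)
    (hXY : PiecewiseIsomorphic X Y)
    (f : X.left.PartialIso Y.left) (hf : f.IsOver X.hom Y.hom) (F : WeakFactorization f) :
    K0Var.lefschetz k * ∑ i : Fin F.n, ∑ j : Fin (F.bSeq i).length,
        (F.bSeq i).centerClass j * K0Var.projClass k (((F.bSeq i).codim j : ℤ) - 2) =
      K0Var.lefschetz k * ∑ i : Fin F.n, ∑ j : Fin (F.cSeq i).length,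
        (F.cSeq i).centerClass j * K0Var.projClass k (((F.cSeq i).codim j : ℤ) - 2) := by
  have := hX.proper
  have := hY.proper
  let x : Fin (F.n + 1) → K0Var k := fun i => K0Var.classOf (F.X' i).hom
  have hb : ∀ i, K0Var.lefschetz k * ∑ j : Fin (F.bSeq i).length,
      (F.bSeq i).centerClass j * K0Var.projClass k (((F.bSeq i).codim j : ℤ) - 2) =
        K0Var.classOf (F.Z i).hom - x i.castSucc := fun i =>
    eq_sub_of_add_eq' (F.bSeq i).classOf_eq.symm
  have hc : ∀ i, K0Var.lefschetz k * ∑ j : Fin (F.cSeq i).length,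
      (F.cSeq i).centerClass j * K0Var.projClass k (((F.cSeq i).codim j : ℤ) - 2) =
        K0Var.classOf (F.Z i).hom - x i.succ := fun i =>
    eq_sub_of_add_eq' (F.cSeq i).classOf_eq.symm
  have h₀ : x 0 = x (Fin.last F.n) := by
    change K0Var.classOf _ = K0Var.classOf _
    rw [K0Var.classOf_eq_of_overIso F.first, K0Var.classOf_eq_of_overIso F.last]
    exact K0Var.classOf_eq_of_piecewiseIsomorphic hXY
  rw [Finset.mul_sum, Finset.mul_sum, Finset.sum_congr rfl fun i _ => hb i,
    Finset.sum_congr rfl fun i _ => hc i, ← sub_eq_zero, ← Finset.sum_sub_distrib]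
  -- The classes of the `Zᵢ` cancel, leaving the telescoping differences of consecutive `Xᵢ`.
  simp only [sub_sub_sub_cancel_left]
  rw [sum_succ_sub_castSucc, h₀, sub_self]
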